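/- Let $D$ be a metric space that is uniformly discrete ($\inf_{x\ne y}d(x,y)>0$) and has bounded geometry (for every $R>0$ the number of points in balls of radius $R$ is uniformly bounded). For a Hilbert space $H$, let $C^*_H(D)$ be the norm closure of the $*$-algebra of all bounded operators $T$ on $\ell^2(D)\otimes H$ that are locally compact ($Tf$ and $fT$ are compact for every $f\in C_0(D)$ acting by multiplication) and of finite propagation (there is $R>0$ with $fTg=0$ whenever $f,g\in C_0(D)$ have supports at distance greater than $R$). Thus $C^*_{\mathbb C}(D)$ is the uniform Roe algebra, which is unital, and for infinite-dimensional $H$ the algebra $C^*_H(D)$ is the Roe algebra of $D$. Fix an infinite-dimensional $H$ and an isometry $V:\mathbb C\to H$, put $V_D=\mathrm{id}\otimes V:\ell^2(D)\to \ell^2(D)\otimes H$, and let $i_D:C^*_{\mathbb C}(D)\to C^*_H(D)$ be the $*$-homomorphism $i_D(T)=V_DTV_D^*$. For $\alpha>0$ let $D(\alpha)$ be the graph with vertex set $D$ in which two distinct points $x,y$ are joined by an edge whenever $d(x,y)\le\alpha$. For a locally finite graph $\Gamma$ with vertex set $\Gamma_0$ and edge set $\Gamma_1$, let $C_k^{BM}(\Gamma)$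 ($k=0,1$) be the group of all (possibly infinite) formal sums $\sum_{x\in\Gamma_k}\lambda_x x$, $\lambda_x\in\mathbb Z$, and let $H_0^{BM}(\Gamma)=C_0^{BM}(\Gamma)/\partial C_1^{BM}(\Gamma)$, where $\partial$ is the usual boundary map (end minus start of an edge, for a chosen orientation of the edges). For $\alpha\le\beta$ the inclusion $D(\alpha)\subset D(\beta)$ induces a map $H_0^{BM}(D(\alpha))\to H_0^{BM}(D(\beta))$. Let $c=\sum_{x\in D}x$ be the $0$-chain with all coefficients equal to $1$; its classes in the groups $H_0^{BM}(D(\alpha))$ are compatible with these maps and define a class $[c]$ in the direct limit. The following are equivalent: 1. $(i_D)_*([1])=0$ in $K_0(C^*_H(D))$; 2. $[c]=0$ in $\varinjlim_{\alpha}H_0^{BM}(D(\alpha))$. -/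

import Mathlib

open scoped ZeroAtInfty ENNReal

noncomputable section

namespace CoarseK

/-! ## Roe algebras -/

section Roe

variable {X : Type*} [MetricSpace X]
  {E : Type*} [NormedAddCommGroup E] [InnerProductSpace ℂ E] [CompleteSpace E]

/-- The distance `inf {d(x, y) : x ∈ s, y ∈ t}` between two sets (it is `∞` if one is empty). -/
def setDist (s t : Set X) : ℝ≥0∞ := ⨅ x ∈ s, ⨅ y ∈ t, edist x y

/-- `T` is locally compact: `T ψ(f)` and `ψ(f) T` are compact for all `f ∈ C₀(X)`. -/
def IsLocallyCompactOp (ψ : C₀(X, ℂ) →⋆ₙₐ[ℂ] (E →L[ℂ] E)) (T : E →L[ℂ] E) : Prop :=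
  ∀ f : C₀(X, ℂ), IsCompactOperator (T * ψ f) ∧ IsCompactOperator (ψ f * T)

/-- `T` has finite propagation: for some `R > 0`, `ψ(f) T ψ(g) = 0` whenever the distance between
the supports of `f, g ∈ C₀(X)` is greater than `R`. -/
def HasFinitePropagation (ψ : C₀(X, ℂ) →⋆ₙₐ[ℂ] (E →L[ℂ] E)) (T : E →L[ℂ] E) : Prop :=
  ∃ R : ℝ, 0 < R ∧ ∀ f g : C₀(X, ℂ),
    ENNReal.ofReal R < setDist (tsupport f) (tsupport g) → ψ f * T * ψ g = 0

/-- The action of `C₀(X)` is nondegenerate: `{ψ(f) ξ}` is dense. -/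
def IsNondegenerate (ψ : C₀(X, ℂ) →⋆ₙₐ[ℂ] (E →L[ℂ] E)) : Prop :=
  Dense {v : E | ∃ (f : C₀(X, ℂ)) (ξ : E), ψ f ξ = v}

lemma isCompactOperator_adjoint {T : E →L[ℂ] E} (hT : IsCompactOperator T) :
    IsCompactOperator (star T : E →L[ℂ] E) := by
  have hS : IsCompactOperator (T * star T) := hT.comp_clm _
  refine (isCompactOperator_iff_isCompact_closure_image_ball (𝕜₁ := ℂ)
    (star T).toLinearMap one_pos).2 ?_
  have h1 := hS.isCompact_closure_image_ball (𝕜₁ := ℂ) (f := (T * star T).toLinearMap) 1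
  refine TotallyBounded.isCompact_of_isClosed (TotallyBounded.closure ?_) isClosed_closure
  have h2 := h1.totallyBounded.subset subset_closure
  refine Metric.totallyBounded_iff.2 fun ε hε => ?_
  obtain ⟨t, hts, htf, htc⟩ :=
    Metric.finite_approx_of_totallyBounded h2 (ε ^ 2 / 2) (by positivity)
  have hts' : ∀ y ∈ t, ∃ v ∈ Metric.ball (0 : E) 1, (T * star T) v = y := fun y hy => hts hy
  choose! u hu using hts'
  refine ⟨(fun y => star T (u y)) '' t, htf.image _, ?_⟩
  rintro _ ⟨v, hv, rfl⟩
  obtain ⟨y, hy, hvy⟩ := Set.mem_iUnion₂.1 (htc ⟨v, hv, rfl⟩)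
  simp only [Set.biUnion_image, Set.mem_iUnion₂, Metric.mem_ball]
  refine ⟨y, hy, ?_⟩
  obtain ⟨hu1, hu2⟩ := hu y hy
  rw [Metric.mem_ball, ← hu2] at hvy
  simp only [ContinuousLinearMap.coe_coe, dist_eq_norm] at hvy ⊢
  rw [← map_sub] at hvy ⊢
  set w := v - u y with hw
  have hwn : ‖w‖ ≤ 2 := by
    refine (norm_sub_le _ _).trans ?_
    have := mem_ball_zero_iff.1 hv
    have := mem_ball_zero_iff.1 hu1
    linarith
  have key : ‖star T w‖ ^ 2 ≤ ‖(T * star T) w‖ * ‖w‖ := by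
    have h := norm_inner_le_norm (𝕜 := ℂ) ((T * star T) w) w
    have h' : inner ℂ ((T * star T) w) w = inner ℂ (star T w) (star T w) := by
      rw [ContinuousLinearMap.star_eq_adjoint, ContinuousLinearMap.adjoint_inner_right]
      rfl
    rw [h', inner_self_eq_norm_sq_to_K] at h
    simpa using h
  have : ‖star T w‖ ^ 2 < ε ^ 2 := by
    have h0 := norm_nonneg ((T * star T) w)
    nlinarith
  exact lt_of_pow_lt_pow_left₀ 2 hε.le this

lemma norm_rep_le (ψ : C₀(X, ℂ) →⋆ₙₐ[ℂ] (E →L[ℂ] E)) (f : C₀(X, ℂ)) : ‖ψ f‖ ≤ ‖f‖ :=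
  NonUnitalStarAlgHom.norm_apply_le ψ f

lemma ofReal_lt_setDist {s t : Set X} {R S : ℝ} (hRS : R < S) (hS : 0 < S)
    (h : ∀ x ∈ s, ∀ y ∈ t, S ≤ dist x y) : ENNReal.ofReal R < setDist s t := by
  refine lt_of_lt_of_le ((ENNReal.ofReal_lt_ofReal_iff hS).2 hRS) ?_
  refine le_iInf₂ fun x hx => le_iInf₂ fun y hy => ?_
  rw [edist_dist]
  exact ENNReal.ofReal_le_ofReal (h x hx y hy)

lemma lt_dist_of_ofReal_lt_setDist {s t : Set X} {R : ℝ}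
    (h : ENNReal.ofReal R < setDist s t) {x y : X} (hx : x ∈ s) (hy : y ∈ t) : R < dist x y := by
  have : ENNReal.ofReal R < edist x y := h.trans_le ((iInf₂_le x hx).trans (iInf₂_le y hy))
  rw [edist_dist] at this
  exact lt_of_not_ge fun h' => absurd (ENNReal.ofReal_le_ofReal h') (not_le.2 this)

lemma setDist_comm (s t : Set X) : setDist s t = setDist t s := by
  unfold setDist
  rw [iInf₂_comm]
  simp_rw [edist_comm]

lemma IsLocallyCompactOp.add {ψ : C₀(X, ℂ) →⋆ₙₐ[ℂ] (E →L[ℂ] E)} {S T : E →L[ℂ] E}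
    (hS : IsLocallyCompactOp ψ S) (hT : IsLocallyCompactOp ψ T) :
    IsLocallyCompactOp ψ (S + T) := fun f => by
  rw [add_mul, mul_add]
  exact ⟨(hS f).1.add (hT f).1, (hS f).2.add (hT f).2⟩

lemma IsLocallyCompactOp.smul {ψ : C₀(X, ℂ) →⋆ₙₐ[ℂ] (E →L[ℂ] E)} {T : E →L[ℂ] E}
    (hT : IsLocallyCompactOp ψ T) (c : ℂ) : IsLocallyCompactOp ψ (c • T) := fun f => by
  rw [smul_mul_assoc, mul_smul_comm]
  exact ⟨(hT f).1.smul c, (hT f).2.smul c⟩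

lemma IsLocallyCompactOp.mul {ψ : C₀(X, ℂ) →⋆ₙₐ[ℂ] (E →L[ℂ] E)} {S T : E →L[ℂ] E}
    (hS : IsLocallyCompactOp ψ S) (hT : IsLocallyCompactOp ψ T) :
    IsLocallyCompactOp ψ (S * T) := fun f => by
  rw [mul_assoc, ← mul_assoc (ψ f)]
  exact ⟨(hT f).1.clm_comp S, (hS f).2.comp_clm T⟩

lemma IsLocallyCompactOp.star {ψ : C₀(X, ℂ) →⋆ₙₐ[ℂ] (E →L[ℂ] E)} {T : E →L[ℂ] E}
    (hT : IsLocallyCompactOp ψ T) : IsLocallyCompactOp ψ (star T) := fun f => by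
  have h := hT (Star.star f)
  constructor
  · simpa [map_star] using isCompactOperator_adjoint h.2
  · simpa [map_star] using isCompactOperator_adjoint h.1

lemma HasFinitePropagation.add {ψ : C₀(X, ℂ) →⋆ₙₐ[ℂ] (E →L[ℂ] E)} {S T : E →L[ℂ] E}
    (hS : HasFinitePropagation ψ S) (hT : HasFinitePropagation ψ T) :
    HasFinitePropagation ψ (S + T) := by
  obtain ⟨R, hR, h⟩ := hS
  obtain ⟨R', hR', h'⟩ := hT
  refine ⟨max R R', lt_max_of_lt_left hR, fun f g hfg => ?_⟩
  rw [mul_add, add_mul, h f g, h' f g, add_zero]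
  · exact (ENNReal.ofReal_le_ofReal (le_max_right _ _)).trans_lt hfg
  · exact (ENNReal.ofReal_le_ofReal (le_max_left _ _)).trans_lt hfg

lemma HasFinitePropagation.smul {ψ : C₀(X, ℂ) →⋆ₙₐ[ℂ] (E →L[ℂ] E)} {T : E →L[ℂ] E}
    (hT : HasFinitePropagation ψ T) (c : ℂ) : HasFinitePropagation ψ (c • T) := by
  obtain ⟨R, hR, h⟩ := hT
  refine ⟨R, hR, fun f g hfg => ?_⟩
  rw [mul_smul_comm, smul_mul_assoc, h f g hfg, smul_zero]

lemma HasFinitePropagation.star {ψ : C₀(X, ℂ) →⋆ₙₐ[ℂ] (E →L[ℂ] E)} {T : E →L[ℂ] E}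
    (hT : HasFinitePropagation ψ T) : HasFinitePropagation ψ (star T) := by
  obtain ⟨R, hR, h⟩ := hT
  refine ⟨R, hR, fun f g hfg => ?_⟩
  have hs : ∀ k : C₀(X, ℂ), tsupport (Star.star k : C₀(X, ℂ)) = tsupport k := fun k => by
    unfold tsupport Function.support
    simp
  have := h (Star.star g) (Star.star f) (by rw [hs, hs, setDist_comm]; exact hfg)
  simpa [map_star, mul_assoc] using congrArg Star.star this

/-- Multiplication of `h ∈ C₀(X)` by a bounded continuous function. -/
def bddMul (φ : C(X, ℝ)) (hφ : ∀ x, |φ x| ≤ 1) (h : C₀(X, ℂ)) : C₀(X, ℂ) where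
  toFun x := (φ x : ℂ) * h x
  continuous_toFun := by fun_prop
  zero_at_infty' := by
    refine squeeze_zero_norm (fun x => ?_) (by simpa using h.zero_at_infty'.norm)
    rw [norm_mul, Complex.norm_real]
    exact mul_le_of_le_one_left (norm_nonneg _) (hφ x)

/-- A nondegenerate action has enough local units. -/
lemma IsNondegenerate.apply_eq_zero {ψ : C₀(X, ℂ) →⋆ₙₐ[ℂ] (E →L[ℂ] E)} (hψ : IsNondegenerate ψ)
    (A : E →L[ℂ] E) (u : E) (h : ∀ e : C₀(X, ℂ), A (ψ e u) = 0) : A u = 0 := by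
  rw [← norm_le_zero_iff]
  refine le_of_forall_pos_le_add fun ε hε => ?_
  obtain ⟨δ, hδ, hδε⟩ : ∃ δ : ℝ, 0 < δ ∧ ‖A‖ * (3 * δ) ≤ ε := by
    refine ⟨ε / (3 * (‖A‖ + 1)), by positivity, ?_⟩
    rw [mul_div_assoc', mul_div_assoc', div_le_iff₀ (by positivity)]
    nlinarith [norm_nonneg A]
  obtain ⟨_, hk, ⟨k, ξ, rfl⟩⟩ := Metric.dense_iff.1 hψ u δ hδ
  rw [Metric.mem_ball, dist_eq_norm, norm_sub_rev] at hk
  set η : ℝ := δ / (‖ξ‖ + 1) with hη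
  have hη0 : 0 < η := by positivity
  let e : C₀(X, ℂ) :=
    { toFun := fun x => ((‖k x‖ / (‖k x‖ + η) : ℝ) : ℂ)
      continuous_toFun := by
        refine Complex.continuous_ofReal.comp (Continuous.div (by fun_prop) (by fun_prop) ?_)
        intro x; positivity
      zero_at_infty' := by
        refine squeeze_zero_norm (a := fun x => ‖k x‖ / η) (fun x => ?_) ?_
        · rw [Complex.norm_real, Real.norm_of_nonneg (by positivity)]
          gcongr
          linarith [norm_nonneg (k x)]
        · simpa using (k.zero_at_infty'.norm).div_const η }
  have he1 : ‖e‖ ≤ 1 := by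
    rw [← ZeroAtInftyContinuousMap.norm_toBCF_eq_norm,
      BoundedContinuousFunction.norm_le zero_le_one]
    intro x
    change ‖((‖k x‖ / (‖k x‖ + η) : ℝ) : ℂ)‖ ≤ 1
    rw [Complex.norm_real, Real.norm_of_nonneg (by positivity)]
    exact div_le_one_of_le₀ (by linarith) (by positivity)
  have he2 : ‖k - e * k‖ ≤ η := by
    rw [← ZeroAtInftyContinuousMap.norm_toBCF_eq_norm,
      BoundedContinuousFunction.norm_le hη0.le]
    intro x
    change ‖k x - ((‖k x‖ / (‖k x‖ + η) : ℝ) : ℂ) * k x‖ ≤ η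
    have hpos : 0 < ‖k x‖ + η := by positivity
    have h1 : k x - ((‖k x‖ / (‖k x‖ + η) : ℝ) : ℂ) * k x
        = ((η / (‖k x‖ + η) : ℝ) : ℂ) * k x := by
      rw [← one_sub_mul, ← Complex.ofReal_one, ← Complex.ofReal_sub]
      congr 2
      field_simp
      ring
    rw [h1, norm_mul, Complex.norm_real, Real.norm_of_nonneg (by positivity), div_mul_eq_mul_div,
      div_le_iff₀ hpos]
    nlinarith [norm_nonneg (k x)]
  have hAu : A u = A (u - ψ k ξ) + A (ψ (k - e * k) ξ) + A (ψ e (ψ k ξ - u)) := by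
    simp [map_sub, h e, map_mul]
  have b1 : ‖A (u - ψ k ξ)‖ ≤ ‖A‖ * δ :=
    (A.le_opNorm _).trans (mul_le_mul_of_nonneg_left hk.le (norm_nonneg _))
  have b2 : ‖A (ψ (k - e * k) ξ)‖ ≤ ‖A‖ * δ := by
    refine (A.le_opNorm _).trans (mul_le_mul_of_nonneg_left ?_ (norm_nonneg _))
    refine ((ψ (k - e * k)).le_opNorm ξ).trans ?_
    calc ‖ψ (k - e * k)‖ * ‖ξ‖ ≤ η * (‖ξ‖ + 1) := by
          gcongr
          · exact (norm_rep_le ψ _).trans he2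
          · linarith
      _ = δ := by rw [hη]; field_simp
  have b3 : ‖A (ψ e (ψ k ξ - u))‖ ≤ ‖A‖ * δ := by
    refine (A.le_opNorm _).trans (mul_le_mul_of_nonneg_left ?_ (norm_nonneg _))
    refine ((ψ e).le_opNorm _).trans ?_
    rw [norm_sub_rev]
    calc ‖ψ e‖ * ‖u - ψ k ξ‖ ≤ 1 * δ := by
          gcongr
          exact (norm_rep_le ψ _).trans he1
      _ = δ := one_mul δ
  rw [hAu]
  refine (norm_add₃_le).trans ?_
  linarith

lemma HasFinitePropagation.mul {ψ : C₀(X, ℂ) →⋆ₙₐ[ℂ] (E →L[ℂ] E)} (hψ : IsNondegenerate ψ)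
    {S T : E →L[ℂ] E} (hS : HasFinitePropagation ψ S) (hT : HasFinitePropagation ψ T) :
    HasFinitePropagation ψ (S * T) := by
  obtain ⟨R, hR, h⟩ := hS
  obtain ⟨R', hR', h'⟩ := hT
  refine ⟨R + R' + 3, by positivity, fun f g hfg => ?_⟩
  rcases (tsupport f).eq_empty_or_nonempty with hf | hf
  · have : f = 0 := by
      ext x
      exact congrFun (tsupport_eq_empty_iff.1 hf) x
    simp [this]
  ext ξ
  have : (ψ f * S) (T (ψ g ξ)) = 0 := by
    refine hψ.apply_eq_zero _ _ fun e => ?_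
    let φ : C(X, ℝ) := ⟨fun x => max 0 (min 1 (R + 2 - Metric.infDist x (tsupport f))), by fun_prop⟩
    have hφ : ∀ x, |φ x| ≤ 1 := fun x => by
      rw [abs_of_nonneg (le_max_left _ _)]
      exact max_le zero_le_one (min_le_left _ _)
    have h1 : ψ f * S * ψ (e - bddMul φ hφ e) = 0 := by
      apply h
      refine ofReal_lt_setDist (S := R + 1) (by linarith) (by linarith) fun x hx y hy => ?_
      have hcl : IsClosed {y | R + 1 ≤ Metric.infDist y (tsupport f)} :=
        isClosed_le continuous_const (Metric.continuous_infDist_pt _)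
      have hsub : tsupport (e - bddMul φ hφ e : C₀(X, ℂ)) ⊆
          {y | R + 1 ≤ Metric.infDist y (tsupport f)} := by
        refine closure_minimal (fun y hy => ?_) hcl
        by_contra hlt
        simp only [Set.mem_ofPred_eq, not_le] at hlt
        apply hy
        have : φ y = 1 := by
          change max 0 (min 1 (R + 2 - Metric.infDist y (tsupport f))) = 1
          rw [min_eq_left (by linarith), max_eq_right zero_le_one]
        change e y - (φ y : ℂ) * e y = 0
        simp [this]
      rw [dist_comm]
      exact (hsub hy).trans (Metric.infDist_le_dist_of_mem hx)
    have h2 : ψ (bddMul φ hφ e) * T * ψ g = 0 := by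
      apply h'
      refine ofReal_lt_setDist (S := R' + 1) (by linarith) (by linarith) fun x hx y hy => ?_
      have hcl : IsClosed {y | Metric.infDist y (tsupport f) ≤ R + 2} :=
        isClosed_le (Metric.continuous_infDist_pt _) continuous_const
      have hsub : tsupport (bddMul φ hφ e : C₀(X, ℂ)) ⊆
          {y | Metric.infDist y (tsupport f) ≤ R + 2} := by
        refine closure_minimal (fun y hy => ?_) hcl
        by_contra hlt
        simp only [Set.mem_ofPred_eq, not_le] at hlt
        apply hy
        have : φ y = 0 := by
          change max 0 (min 1 (R + 2 - Metric.infDist y (tsupport f))) = 0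
          exact max_eq_left ((min_le_right _ _).trans (by linarith))
        change (φ y : ℂ) * e y = 0
        simp [this]
      have hx' : Metric.infDist x (tsupport f) ≤ R + 2 := hsub hx
      have hy' : R + R' + 3 ≤ Metric.infDist y (tsupport f) :=
        (Metric.le_infDist hf).2 fun z hz => by
          rw [dist_comm]
          exact (lt_dist_of_ofReal_lt_setDist hfg hz hy).le
      have := Metric.infDist_le_infDist_add_dist (s := tsupport f) (x := y) (y := x)
      rw [dist_comm] at this
      linarith
    have e1 := congrArg (fun W : E →L[ℂ] E => W (T (ψ g ξ))) h1
    have e2 := congrArg (fun W : E →L[ℂ] E => W ξ) h2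
    simp only [map_sub, mul_sub, sub_apply, mul_apply_eq_comp,
      zero_apply] at e1 e2 ⊢
    rw [e2, map_zero, map_zero, sub_zero] at e1
    exact e1
  simpa using this

/-- The `*`-algebra of locally compact operators of finite propagation. -/
def finitePropagationAlgebra (ψ : C₀(X, ℂ) →⋆ₙₐ[ℂ] (E →L[ℂ] E)) (hψ : IsNondegenerate ψ) :
    NonUnitalStarSubalgebra ℂ (E →L[ℂ] E) where
  carrier := {T | IsLocallyCompactOp ψ T ∧ HasFinitePropagation ψ T}
  add_mem' hS hT := ⟨hS.1.add hT.1, hS.2.add hT.2⟩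
  zero_mem' := ⟨fun f => by simpa using isCompactOperator_zero, 1, one_pos, by simp⟩
  mul_mem' hS hT := ⟨hS.1.mul hT.1, hS.2.mul hψ hT.2⟩
  smul_mem' c _ hT := ⟨hT.1.smul c, hT.2.smul c⟩
  star_mem' hT := ⟨hT.1.star, hT.2.star⟩

/-- The Roe algebra `C*(X, E)`: the norm closure of the `*`-algebra of locally compact operators of
finite propagation. -/
def roeAlgebra (ψ : C₀(X, ℂ) →⋆ₙₐ[ℂ] (E →L[ℂ] E)) (hψ : IsNondegenerate ψ) :
    NonUnitalStarSubalgebra ℂ (E →L[ℂ] E) :=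
  (finitePropagationAlgebra ψ hψ).topologicalClosure

end Roe

/-! ## Discrete metric spaces and their Roe algebras -/

/-- A metric space is uniformly discrete if `inf {d(x, y) : x ≠ y} > 0`. -/
class IsUniformlyDiscrete (D : Type*) [MetricSpace D] : Prop where
  exists_pos_le_dist : ∃ δ : ℝ, 0 < δ ∧ ∀ x y : D, x ≠ y → δ ≤ dist x y

/-- A discrete metric space has bounded geometry if, for each `R > 0`, the number of points in
balls of radius `R` is uniformly bounded. -/
class HasBoundedGeometry (D : Type*) [MetricSpace D] : Prop where
  exists_encard_closedBall_le : ∀ R : ℝ, 0 < R →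
    ∃ N : ℕ, ∀ x : D, (Metric.closedBall x R).encard ≤ N

instance (D : Type*) [MetricSpace D] [h : IsUniformlyDiscrete D] : DiscreteTopology D := by
  obtain ⟨δ, hδ, h⟩ := h.exists_pos_le_dist
  refine discreteTopology_iff_isOpen_singleton.2 fun x => Metric.isOpen_iff.2 ?_
  rintro _ rfl
  refine ⟨δ, hδ, fun y hy => ?_⟩
  by_contra hne
  exact absurd (h _ _ hne) (not_le.2 hy)

/-- The Hilbert space `L²(D) ⊗ H` (for the counting measure on `D`), as the space `ℓ²(D; H)` of
square-summable functions from `D` to `H`. -/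
abbrev L2 (D H : Type*) [NormedAddCommGroup H] : Type _ := lp (fun _ : D => H) 2

lemma sum_single_apply {D : Type*} [DecidableEq D] {H : Type*} [NormedAddCommGroup H]
    (F : Finset D) (u : D → H) (x : D) :
    (∑ y ∈ F, lp.single 2 y (u y) : L2 D H) x = if x ∈ F then u x else 0 := by
  rw [lp.coeFn_sum, Finset.sum_apply]
  simp [lp.single_apply, Pi.single_apply]

section Discrete

variable (D : Type*) [MetricSpace D]
  (H : Type*) [NormedAddCommGroup H] [InnerProductSpace ℂ H]

variable {D}

/-- The operator on `ℓ²(D; H)` of multiplication by `f ∈ C₀(D)`. -/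
def mulOp (f : C₀(D, ℂ)) : L2 D H →L[ℂ] L2 D H :=
  LinearMap.mkContinuous
    { toFun := fun v => ⟨fun x => f x • v x, by
        have hb : ∀ x, ‖f x • v x‖ ≤ ‖(‖f‖ : ℂ) • v x‖ := fun x => by
          rw [norm_smul, norm_smul, Complex.norm_real, norm_norm]
          gcongr
          exact f.toBCF.norm_coe_le_norm x
        exact ((lp.memℓp v).const_smul (‖f‖ : ℂ)).mono' hb⟩
      map_add' := fun u v => by ext x; exact smul_add _ _ _
      map_smul' := fun c v => by ext x; exact smul_comm _ _ _ }
    ‖f‖ fun v => by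
      have hv : ‖(‖f‖ : ℂ) • v‖ = ‖f‖ * ‖v‖ := by
        rw [norm_smul, Complex.norm_real, norm_norm]
      rw [← hv]
      refine lp.norm_mono (by norm_num) fun x => ?_
      change ‖f x • v x‖ ≤ ‖(‖f‖ : ℂ) • v x‖
      rw [norm_smul, norm_smul, Complex.norm_real, norm_norm]
      gcongr
      exact f.toBCF.norm_coe_le_norm x

@[simp] lemma mulOp_apply (f : C₀(D, ℂ)) (v : L2 D H) (x : D) : mulOp H f v x = f x • v x := rfl

variable (D) [CompleteSpace H]

/-- The standard action of `C₀(D)` on `ℓ²(D; H)` by multiplication. -/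
def mulRep : C₀(D, ℂ) →⋆ₙₐ[ℂ] (L2 D H →L[ℂ] L2 D H) where
  toFun := mulOp H
  map_smul' c f := by ext v x; simp [mul_smul]
  map_zero' := by ext v x; simp
  map_add' f g := by ext v x; simp [add_smul]
  map_mul' f g := by ext v x; simp [mul_smul]
  map_star' f := by
    rw [ContinuousLinearMap.star_eq_adjoint, ContinuousLinearMap.eq_adjoint_iff]
    intro u v
    rw [lp.inner_eq_tsum, lp.inner_eq_tsum]
    congr 1
    ext x
    simp [inner_smul_left, inner_smul_right]

@[simp] lemma mulRep_apply (f : C₀(D, ℂ)) (v : L2 D H) (x : D) :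
    mulRep D H f v x = f x • v x := rfl

variable {D}

/-- The function that agrees with `f` on the finite set `F` and vanishes elsewhere. -/
def restrictFinset [DiscreteTopology D] (f : D → ℂ) (F : Finset D) : C₀(D, ℂ) where
  toFun := (F : Set D).indicator f
  continuous_toFun := continuous_of_discreteTopology
  zero_at_infty' := by
    refine tendsto_nhds_of_eventually_eq ?_
    rw [Filter.cocompact_eq_cofinite]
    filter_upwards [F.finite_toSet.compl_mem_cofinite] with x hx
    exact Set.indicator_of_notMem hx f

variable (D)

lemma isNondegenerate_mulRep [DiscreteTopology D] : IsNondegenerate (mulRep D H) := by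
  classical
  intro v
  refine mem_closure_of_tendsto (lp.hasSum_single (by norm_num) v) (Filter.Eventually.of_forall ?_)
  intro F
  refine ⟨restrictFinset 1 F, v, ?_⟩
  ext x
  rw [mulRep_apply, sum_single_apply]
  by_cases hx : x ∈ F <;> simp [restrictFinset, hx]

variable [DiscreteTopology D]

/-- The Roe algebra `C*_H(D)` of operators on `ℓ²(D; H)`. For `H = ℂ` it is the uniform Roe algebra
of `D`, for infinite-dimensional `H` it is the Roe algebra of `D`. -/
abbrev RoeAlg : NonUnitalStarSubalgebra ℂ (L2 D H →L[ℂ] L2 D H) :=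
  roeAlgebra (mulRep D H) (isNondegenerate_mulRep D H)

lemma isCompactOperator_mulRep (f : C₀(D, ℂ)) : IsCompactOperator (mulRep D ℂ f) := by
  classical
  have hcl := isClosed_setOfPred_isCompactOperator (𝕜₁ := ℂ) (𝕜₂ := ℂ) (σ₁₂ := RingHom.id ℂ)
    (M₁ := L2 D ℂ) (M₂ := L2 D ℂ)
  refine hcl.closure_subset (Metric.mem_closure_iff.2 fun ε hε => ?_)
  have hfin : {x | ε / 2 ≤ ‖f x‖}.Finite := by
    have h := f.zero_at_infty'.norm
    rw [Filter.cocompact_eq_cofinite, norm_zero] at h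
    have := h.eventually (gt_mem_nhds (half_pos hε))
    rw [Filter.eventually_cofinite] at this
    simpa using this
  refine ⟨mulRep D ℂ (restrictFinset f hfin.toFinset), ?_, ?_⟩
  · have heq : mulRep D ℂ (restrictFinset f hfin.toFinset) = ∑ x ∈ hfin.toFinset,
        (lp.singleContinuousLinearMap ℂ (fun _ : D => ℂ) 2 x) ∘L
          (f x • lp.evalCLM ℂ (fun _ : D => ℂ) 2 x) := by
      ext v x
      rw [sum_apply, mulRep_apply]
      refine Eq.trans ?_ (sum_single_apply hfin.toFinset (fun y => f y • v y) x).symm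
      by_cases hx : x ∈ hfin.toFinset
      · rw [if_pos hx]
        congr 1
        exact Set.indicator_of_mem hx _
      · rw [if_neg hx]
        have : restrictFinset (f : D → ℂ) hfin.toFinset x = 0 := Set.indicator_of_notMem hx _
        rw [this, zero_smul]
    change IsCompactOperator (mulRep D ℂ (restrictFinset f hfin.toFinset))
    rw [heq]
    refine Submodule.sum_mem (compactOperator (RingHom.id ℂ) (L2 D ℂ) (L2 D ℂ)) fun x _ => ?_
    exact IsCompactOperator.comp_clm (f := lp.singleContinuousLinearMap ℂ (fun _ : D => ℂ) 2 x)
      (isCompactOperator_of_locallyCompactSpace_rng _) (f x • lp.evalCLM ℂ (fun _ : D => ℂ) 2 x)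
  · rw [dist_eq_norm, ← map_sub]
    refine (norm_rep_le _ _).trans_lt (lt_of_le_of_lt ?_ (half_lt_self hε))
    rw [← ZeroAtInftyContinuousMap.norm_toBCF_eq_norm,
      BoundedContinuousFunction.norm_le (half_pos hε).le]
    intro x
    change ‖f x - ((hfin.toFinset : Set D).indicator f) x‖ ≤ ε / 2
    by_cases hx : x ∈ hfin.toFinset
    · rw [Set.indicator_of_mem hx, sub_self, norm_zero]
      positivity
    · rw [Set.indicator_of_notMem hx, sub_zero]
      simp only [Set.Finite.mem_toFinset, Set.mem_ofPred_eq, not_le] at hx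
      exact hx.le

lemma one_mem_uniformRoe : (1 : L2 D ℂ →L[ℂ] L2 D ℂ) ∈ RoeAlg D ℂ := by
  refine NonUnitalStarSubalgebra.le_topologicalClosure _ ⟨fun f => ?_, 1, one_pos, fun f g hfg => ?_⟩
  · rw [one_mul, mul_one]
    exact ⟨isCompactOperator_mulRep D f, isCompactOperator_mulRep D f⟩
  · rw [mul_one, ← map_mul]
    have : f * g = 0 := by
      ext x
      by_contra hx
      have hf : x ∈ tsupport f := subset_closure fun h => hx (by simp [h])
      have hg : x ∈ tsupport g := subset_closure fun h => hx (by simp [h])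
      have := lt_dist_of_ofReal_lt_setDist hfg hf hg
      rw [dist_self] at this
      linarith
    rw [this, map_zero]

/-- The unit of the uniform Roe algebra. -/
def uniformRoeOne : RoeAlg D ℂ := ⟨1, one_mem_uniformRoe D⟩

variable {H}

/-- The isometry `V_D = id ⊗ V : ℓ²(D) → ℓ²(D; H)` given by an isometry `V : ℂ → H`. -/
def isoD (V : ℂ →ₗᵢ[ℂ] H) : L2 D ℂ →ₗᵢ[ℂ] L2 D H where
  toFun v := ⟨fun x => V (v x), (lp.memℓp v).mono' fun x => (V.norm_map _).le⟩
  map_add' u v := by ext x; exact map_add V _ _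
  map_smul' c v := by ext x; exact map_smul V _ _
  norm_map' v := le_antisymm
    (lp.norm_mono (by norm_num) fun x => (V.norm_map _).le)
    (lp.norm_mono (by norm_num) fun x => (V.norm_map _).ge)

lemma adjoint_apply_iso {E F : Type*} [NormedAddCommGroup E] [InnerProductSpace ℂ E]
    [CompleteSpace E] [NormedAddCommGroup F] [InnerProductSpace ℂ F] [CompleteSpace F]
    (W : E →ₗᵢ[ℂ] F) (v : E) :
    ContinuousLinearMap.adjoint W.toContinuousLinearMap (W v) = v := by
  refine ext_inner_right ℂ fun w => ?_
  rw [ContinuousLinearMap.adjoint_inner_left]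
  exact W.inner_map_map v w

/-- `T ↦ W T W*`. -/
def conjIso {E F : Type*} [NormedAddCommGroup E] [InnerProductSpace ℂ E] [CompleteSpace E]
    [NormedAddCommGroup F] [InnerProductSpace ℂ F] [CompleteSpace F] (W : E →ₗᵢ[ℂ] F) :
    (E →L[ℂ] E) →⋆ₙₐ[ℂ] (F →L[ℂ] F) where
  toFun T := W.toContinuousLinearMap ∘L T ∘L ContinuousLinearMap.adjoint W.toContinuousLinearMap
  map_smul' c T := by ext v; simp
  map_zero' := by ext v; simp
  map_add' S T := by ext v; simp
  map_mul' S T := by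
    ext v
    simp [adjoint_apply_iso]
  map_star' T := by
    simp only [ContinuousLinearMap.star_eq_adjoint, ContinuousLinearMap.adjoint_comp,
      ContinuousLinearMap.adjoint_adjoint, ContinuousLinearMap.comp_assoc]

lemma conjIso_mem (V : ℂ →ₗᵢ[ℂ] H) {T : L2 D ℂ →L[ℂ] L2 D ℂ} (hT : T ∈ RoeAlg D ℂ) :
    conjIso (isoD D V) T ∈ RoeAlg D H := by
  set W := isoD D V
  have hc : Continuous (conjIso W) :=
    AddMonoidHomClass.continuous_of_bound (conjIso W) 1 fun T => by
      rw [one_mul]; exact NonUnitalStarAlgHom.norm_apply_le _ T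
  have h1 : ∀ f : C₀(D, ℂ), mulRep D H f ∘L W.toContinuousLinearMap =
      W.toContinuousLinearMap ∘L mulRep D ℂ f := fun f => by
    ext v x
    change f x • V (v x) = V (f x • v x)
    rw [map_smul]
  have h2 : ∀ f : C₀(D, ℂ), ContinuousLinearMap.adjoint W.toContinuousLinearMap ∘L mulRep D H f =
      mulRep D ℂ f ∘L ContinuousLinearMap.adjoint W.toContinuousLinearMap := fun f => by
    have := congrArg ContinuousLinearMap.adjoint (h1 (star f))
    simp only [ContinuousLinearMap.adjoint_comp, map_star, ContinuousLinearMap.star_eq_adjoint,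
      ContinuousLinearMap.adjoint_adjoint] at this
    exact this
  have h3 : ∀ (f : C₀(D, ℂ)) (S : L2 D ℂ →L[ℂ] L2 D ℂ),
      mulRep D H f * conjIso W S = conjIso W (mulRep D ℂ f * S) := fun f S => by
    change mulRep D H f ∘L (W.toContinuousLinearMap ∘L (S ∘L _)) =
      W.toContinuousLinearMap ∘L ((mulRep D ℂ f ∘L S) ∘L _)
    rw [← ContinuousLinearMap.comp_assoc, h1]
    rfl
  have h4 : ∀ (f : C₀(D, ℂ)) (S : L2 D ℂ →L[ℂ] L2 D ℂ),
      conjIso W S * mulRep D H f = conjIso W (S * mulRep D ℂ f) := fun f S => by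
    change (W.toContinuousLinearMap ∘L (S ∘L _)) ∘L mulRep D H f =
      W.toContinuousLinearMap ∘L ((S ∘L mulRep D ℂ f) ∘L _)
    rw [ContinuousLinearMap.comp_assoc, ContinuousLinearMap.comp_assoc, h2]
    rfl
  have hK : ∀ S : L2 D ℂ →L[ℂ] L2 D ℂ, IsCompactOperator S → IsCompactOperator (conjIso W S) :=
    fun S hS => (hS.comp_clm (ContinuousLinearMap.adjoint W.toContinuousLinearMap)).clm_comp
      W.toContinuousLinearMap
  refine map_mem_closure hc hT fun S hS => ⟨fun f => ?_, ?_⟩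
  · rw [h3, h4]
    exact ⟨hK _ (hS.1 f).1, hK _ (hS.1 f).2⟩
  · obtain ⟨R, hR, h⟩ := hS.2
    refine ⟨R, hR, fun f g hfg => ?_⟩
    rw [h3, h4, h f g hfg, map_zero]

/-- The `*`-homomorphism `i_D : C*_ℂ(D) → C*_H(D)`, `T ↦ V_D T V_D*`. -/
def iD (V : ℂ →ₗᵢ[ℂ] H) : RoeAlg D ℂ →⋆ₙₐ[ℂ] RoeAlg D H :=
  NonUnitalStarAlgHom.codRestrict
    ((conjIso (isoD D V)).comp (NonUnitalStarSubalgebraClass.subtype (RoeAlg D ℂ))) (RoeAlg D H)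
    fun T => conjIso_mem D V T.2

end Discrete

/-! ## K-theory -/

section KTheory

open Matrix

section Unital

variable {A : Type*} [Ring A] [StarRing A]
  {k l m n : Type*} [Fintype k] [Fintype l] [Fintype m] [Fintype n]

/-- Murray–von Neumann equivalence of two projections in matrix algebras over `A` (possibly of
different sizes): `p = v* v` and `q = v v*` for a rectangular matrix `v`. -/
def MvN (p : Matrix m m A) (q : Matrix n n A) : Prop :=
  ∃ v : Matrix n m A, vᴴ * v = p ∧ v * vᴴ = q

lemma MvN.refl {p : Matrix m m A} (hp : IsStarProjection p) : MvN p p := by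
  refine ⟨p, ?_, ?_⟩ <;>
  · rw [← star_eq_conjTranspose, hp.isSelfAdjoint.star_eq]
    exact hp.isIdempotentElem

lemma MvN.symm {p : Matrix m m A} {q : Matrix n n A} : MvN p q → MvN q p := by
  rintro ⟨v, rfl, rfl⟩
  exact ⟨vᴴ, by simp, by simp⟩

lemma MvN.trans {p : Matrix m m A} {q : Matrix n n A} {r : Matrix l l A}
    (hp : IsStarProjection p) (hr : IsStarProjection r) :
    MvN p q → MvN q r → MvN p r := by
  rintro ⟨v, rfl, hv⟩ ⟨w, hw, rfl⟩
  refine ⟨w * v, ?_, ?_⟩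
  · have h := hp.isIdempotentElem.eq
    rw [conjTranspose_mul, Matrix.mul_assoc, ← Matrix.mul_assoc wᴴ, hw, ← hv, ← h]
    simp only [Matrix.mul_assoc]
  · have h := hr.isIdempotentElem.eq
    rw [conjTranspose_mul, Matrix.mul_assoc, ← Matrix.mul_assoc v, hv, ← hw, ← h]
    simp only [Matrix.mul_assoc]

lemma MvN.reindex {p : Matrix m m A} (hp : IsStarProjection p) (e : m ≃ n) :
    MvN p (Matrix.reindex e e p) := by
  have h1 : pᴴ = p := hp.isSelfAdjoint
  have h2 : p * p = p := hp.isIdempotentElem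
  refine ⟨p.submatrix e.symm id, ?_, ?_⟩
  · rw [conjTranspose_submatrix, h1, submatrix_mul_equiv (e₂ := e.symm), h2, submatrix_id_id]
  · rw [conjTranspose_submatrix, h1,
      ← submatrix_mul _ _ _ _ _ Function.bijective_id, h2]
    rfl

lemma MvN.fromBlocks {p : Matrix m m A} {q : Matrix n n A} {p' : Matrix k k A} {q' : Matrix l l A} :
    MvN p q → MvN p' q' → MvN (Matrix.fromBlocks p 0 0 p') (Matrix.fromBlocks q 0 0 q') := by
  rintro ⟨v, rfl, rfl⟩ ⟨w, rfl, rfl⟩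
  exact ⟨Matrix.fromBlocks v 0 0 w, by simp [fromBlocks_conjTranspose, fromBlocks_multiply],
    by simp [fromBlocks_conjTranspose, fromBlocks_multiply]⟩

lemma isStarProjection_fromBlocks {p : Matrix m m A} {q : Matrix n n A}
    (hp : IsStarProjection p) (hq : IsStarProjection q) :
    IsStarProjection (Matrix.fromBlocks p 0 0 q) := by
  have h1 : pᴴ = p := hp.isSelfAdjoint
  have h2 : qᴴ = q := hq.isSelfAdjoint
  have h3 : p * p = p := hp.isIdempotentElem
  have h4 : q * q = q := hq.isIdempotentElem
  constructor
  · simp [IsIdempotentElem, fromBlocks_multiply, h3, h4]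
  · simp [IsSelfAdjoint, star_eq_conjTranspose, fromBlocks_conjTranspose, h1, h2]

lemma isStarProjection_reindex {p : Matrix m m A} (hp : IsStarProjection p) (e : m ≃ n) :
    IsStarProjection (Matrix.reindex e e p) := by
  have h1 : pᴴ = p := hp.isSelfAdjoint
  have h3 : p * p = p := hp.isIdempotentElem
  constructor
  · rw [IsIdempotentElem, reindex_apply, submatrix_mul_equiv, h3]
  · rw [IsSelfAdjoint, star_eq_conjTranspose, reindex_apply, conjTranspose_submatrix, h1]

variable (A) in
/-- Projections in the matrix algebras `Mₙ(A)`, `n ∈ ℕ`. -/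
structure MatProj where
  /-- the size -/
  size : ℕ
  /-- the matrix -/
  mat : Matrix (Fin size) (Fin size) A
  isProj : IsStarProjection mat

namespace MatProj

/-- Block sum `p ⊕ q = diag(p, q)`. -/
def add (p q : MatProj A) : MatProj A where
  size := p.size + q.size
  mat := Matrix.reindex finSumFinEquiv finSumFinEquiv (Matrix.fromBlocks p.mat 0 0 q.mat)
  isProj := isStarProjection_reindex (isStarProjection_fromBlocks p.isProj q.isProj) _

variable (A) in
/-- Murray–von Neumann equivalence as a setoid. -/
instance setoid : Setoid (MatProj A) where
  r p q := MvN p.mat q.mat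
  iseqv := ⟨fun p => MvN.refl p.isProj, MvN.symm, fun {p _ r} => MvN.trans p.isProj r.isProj⟩

lemma equiv_iff {p q : MatProj A} : p ≈ q ↔ MvN p.mat q.mat := Iff.rfl

lemma add_mat (p q : MatProj A) : MvN (Matrix.fromBlocks p.mat 0 0 q.mat) (p.add q).mat :=
  MvN.reindex (isStarProjection_fromBlocks p.isProj q.isProj) _

end MatProj

variable (A) in
/-- The monoid `V(A)` of Murray–von Neumann classes of projections in matrix algebras over `A`. -/
def ProjMonoid : Type _ := Quotient (MatProj.setoid A)

namespace ProjMonoid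

/-- The class of a projection. -/
def mk (p : MatProj A) : ProjMonoid A := Quotient.mk _ p

lemma mk_eq_mk {p q : MatProj A} : mk p = mk q ↔ MvN p.mat q.mat := Quotient.eq

instance : Add (ProjMonoid A) where
  add := Quotient.map₂ MatProj.add fun p p' h q q' h' =>
    ((p.add_mat q).symm.trans (p.add q).isProj
      (isStarProjection_fromBlocks p'.isProj q'.isProj) (h.fromBlocks h')).trans
      (p.add q).isProj (p'.add q').isProj (p'.add_mat q')

instance : Zero (ProjMonoid A) where
  zero := mk ⟨0, 0, .zero _⟩

lemma mk_add_mk (p q : MatProj A) : mk p + mk q = mk (p.add q) := rfl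

/-- A class depends only on a projection matrix up to reindexing. -/
lemma mk_eq_mk_of_reindex {p q : MatProj A} {P : Matrix m m A} {Q : Matrix n n A}
    (hP : IsStarProjection P) (hQ : IsStarProjection Q) (hp : MvN P p.mat) (hq : MvN Q q.mat)
    (e : m ≃ n) (he : Matrix.reindex e e P = Q) : mk p = mk q := by
  subst he
  exact mk_eq_mk.2 ((hp.symm.trans p.isProj hQ (MvN.reindex hP e)).trans p.isProj q.isProj hq)

protected lemma add_assoc (a b c : ProjMonoid A) : a + b + c = a + (b + c) := by
  obtain ⟨p⟩ := a
  obtain ⟨q⟩ := b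
  obtain ⟨r⟩ := c
  have h1 := isStarProjection_fromBlocks p.isProj q.isProj
  have h2 := isStarProjection_fromBlocks q.isProj r.isProj
  have h1' := isStarProjection_fromBlocks (p.add q).isProj r.isProj
  have h2' := isStarProjection_fromBlocks p.isProj (q.add r).isProj
  refine mk_eq_mk_of_reindex (p := (p.add q).add r) (q := p.add (q.add r))
    (isStarProjection_fromBlocks h1 r.isProj) (isStarProjection_fromBlocks p.isProj h2)
    ?_ ?_ (Equiv.sumAssoc _ _ _) ?_
  · exact (((p.add_mat q).fromBlocks (MvN.refl r.isProj)).trans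
      (isStarProjection_fromBlocks h1 r.isProj) ((p.add q).add r).isProj ((p.add q).add_mat r))
  · exact (((MvN.refl p.isProj).fromBlocks (q.add_mat r)).trans
      (isStarProjection_fromBlocks p.isProj h2) (p.add (q.add r)).isProj (p.add_mat (q.add r)))
  · ext (i | i | i) (j | j | j) <;> rfl

protected lemma add_comm (a b : ProjMonoid A) : a + b = b + a := by
  obtain ⟨p⟩ := a
  obtain ⟨q⟩ := b
  refine mk_eq_mk_of_reindex (p := p.add q) (q := q.add p)
    (isStarProjection_fromBlocks p.isProj q.isProj)
    (isStarProjection_fromBlocks q.isProj p.isProj)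
    (p.add_mat q) (q.add_mat p) (Equiv.sumComm _ _) ?_
  ext (i | i) (j | j) <;> rfl

protected lemma zero_add (a : ProjMonoid A) : 0 + a = a := by
  obtain ⟨p⟩ := a
  refine mk_eq_mk_of_reindex (p := MatProj.add ⟨0, 0, .zero _⟩ p) (q := p)
    (isStarProjection_fromBlocks (.zero _) p.isProj) p.isProj
    (MatProj.add_mat ⟨0, 0, .zero _⟩ p) (MvN.refl p.isProj) (Equiv.emptySum (Fin 0) _) ?_
  ext i j
  rfl

instance : AddCommMonoid (ProjMonoid A) where
  add_assoc := ProjMonoid.add_assoc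
  zero_add := ProjMonoid.zero_add
  add_zero a := by rw [ProjMonoid.add_comm, ProjMonoid.zero_add]
  add_comm := ProjMonoid.add_comm
  nsmul := nsmulRec

end ProjMonoid

variable (A) in
/-- `K₀₀(A)`: the Grothendieck group of `V(A)`. For a unital C*-algebra `A` this is `K₀(A)`. -/
abbrev K00 : Type _ := Algebra.GrothendieckAddGroup (ProjMonoid A)

/-- The class of a projection in a matrix algebra. -/
def K00.mk (p : MatProj A) : K00 A := Algebra.GrothendieckAddGroup.of (ProjMonoid.mk p)

end Unital

section Functoriality

variable {A B : Type*} [Ring A] [StarRing A] [Algebra ℂ A] [Ring B] [StarRing B] [Algebra ℂ B]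

/-- A `*`-homomorphism applied to the entries of a projection. -/
def MatProj.map (φ : A →⋆ₐ[ℂ] B) (p : MatProj A) : MatProj B where
  size := p.size
  mat := p.mat.map φ
  isProj := by
    have h1 : p.matᴴ = p.mat := p.isProj.isSelfAdjoint
    have h3 : p.mat * p.mat = p.mat := p.isProj.isIdempotentElem
    constructor
    · rw [IsIdempotentElem, ← Matrix.map_mul, h3]
    · rw [IsSelfAdjoint, star_eq_conjTranspose, ← conjTranspose_map _ (map_star φ), h1]

lemma MvN.map {m n : Type*} [Fintype m] [Fintype n] (φ : A →⋆ₐ[ℂ] B) {p : Matrix m m A}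
    {q : Matrix n n A} : MvN p q → MvN (p.map φ) (q.map φ) := by
  rintro ⟨v, rfl, rfl⟩
  refine ⟨v.map φ, ?_, ?_⟩ <;>
  rw [← conjTranspose_map _ (map_star φ), ← Matrix.map_mul]

/-- The map `V(A) → V(B)` induced by a `*`-homomorphism. -/
def ProjMonoid.map (φ : A →⋆ₐ[ℂ] B) : ProjMonoid A →+ ProjMonoid B where
  toFun := Quotient.map (MatProj.map φ) fun _ _ h => MvN.map φ h
  map_zero' := by
    refine ProjMonoid.mk_eq_mk.2 ⟨0, ?_, ?_⟩ <;> ext i <;> exact i.elim0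
  map_add' := by
    rintro ⟨p⟩ ⟨q⟩
    refine congrArg (Quotient.mk _) ?_
    unfold MatProj.map MatProj.add
    congr 1
    change (Matrix.reindex finSumFinEquiv finSumFinEquiv (fromBlocks p.mat 0 0 q.mat)).map φ =
      Matrix.reindex finSumFinEquiv finSumFinEquiv (fromBlocks (p.mat.map φ) 0 0 (q.mat.map φ))
    rw [reindex_apply, reindex_apply, ← submatrix_map, fromBlocks_map]
    simp

/-- The map `K₀₀(A) → K₀₀(B)` induced by a `*`-homomorphism. -/
def K00.map (φ : A →⋆ₐ[ℂ] B) : K00 A →+ K00 B :=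
  Algebra.GrothendieckAddGroup.lift (Algebra.GrothendieckAddGroup.of.comp (ProjMonoid.map φ))

lemma K00.map_mk (φ : A →⋆ₐ[ℂ] B) (p : MatProj A) : K00.map φ (K00.mk p) = K00.mk (p.map φ) :=
  DFunLike.congr_fun (Algebra.GrothendieckAddGroup.lift.symm_apply_apply
    (Algebra.GrothendieckAddGroup.of.comp (ProjMonoid.map φ))) (ProjMonoid.mk p)

lemma K00.map_comp {C : Type*} [Ring C] [StarRing C] [Algebra ℂ C] (ψ : B →⋆ₐ[ℂ] C)
    (φ : A →⋆ₐ[ℂ] B) (x : K00 A) : K00.map (ψ.comp φ) x = K00.map ψ (K00.map φ x) := by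
  refine DFunLike.congr_fun (g := (K00.map ψ).comp (K00.map φ))
    (Algebra.GrothendieckAddGroup.lift.symm.injective ?_) x
  ext ⟨p⟩
  change K00.map (ψ.comp φ) (K00.mk p) = K00.map ψ (K00.map φ (K00.mk p))
  rw [K00.map_mk, K00.map_mk, K00.map_mk]
  rfl

end Functoriality

section NonUnital

variable (A : Type*) [NonUnitalRing A] [StarRing A] [Module ℂ A] [IsScalarTower ℂ A A]
  [SMulCommClass ℂ A A] [StarModule ℂ A]
  {B : Type*} [NonUnitalRing B] [StarRing B] [Module ℂ B] [IsScalarTower ℂ B B]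
  [SMulCommClass ℂ B B] [StarModule ℂ B]

/-- The quotient map `A⁺ → ℂ` of the unitization `A⁺ = A ⊕ ℂ 1`. -/
def scalarPart : Unitization ℂ A →⋆ₐ[ℂ] ℂ where
  toAlgHom := Unitization.fstHom ℂ A
  map_star' _ := rfl

/-- The group `K₀(A)` of a (possibly nonunital) C*-algebra `A`: the kernel of the map
`K₀₀(A⁺) → K₀₀(ℂ)` induced by the quotient map `A⁺ → ℂ`. -/
def K0 : AddSubgroup (K00 (Unitization ℂ A)) := (K00.map (scalarPart A)).ker

variable {A}

/-- The homomorphism `φ_* : K₀(A) → K₀(B)` induced by a `*`-homomorphism `φ : A → B`. -/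
def K0.map (φ : A →⋆ₙₐ[ℂ] B) : K0 A →+ K0 B :=
  ((K00.map (Unitization.starMap φ)).comp (K0 A).subtype).codRestrict (K0 B) fun x => by
    have h : (scalarPart B).comp (Unitization.starMap φ) = scalarPart A := by
      ext x
      change (Unitization.starMap φ (x : Unitization ℂ A)).fst = (x : Unitization ℂ A).fst
      simp
    change K00.map (scalarPart B) (K00.map (Unitization.starMap φ) x.1) = 0
    rw [← K00.map_comp, h]
    exact x.2

/-- The projection `p ∈ A`, as a `1 × 1` matrix over the unitization. -/
def projMat {p : A} (hp : IsStarProjection p) : MatProj (Unitization ℂ A) where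
  size := 1
  mat := Matrix.of fun _ _ => (p : Unitization ℂ A)
  isProj := by
    constructor
    · refine Matrix.ext fun i j => ?_
      simp [Matrix.mul_apply, ← Unitization.inr_mul, hp.isIdempotentElem.eq]
    · refine Matrix.ext fun i j => ?_
      simp [Matrix.star_apply, ← Unitization.inr_star, hp.isSelfAdjoint.star_eq]

/-- The class `[p] ∈ K₀(A)` of a projection `p ∈ A`. -/
def K0.ofProj {p : A} (hp : IsStarProjection p) : K0 A :=
  ⟨K00.mk (projMat hp), by
    change K00.map (scalarPart A) _ = 0
    rw [K00.map_mk]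
    have : ProjMonoid.mk ((projMat hp).map (scalarPart A)) = 0 := by
      refine ProjMonoid.mk_eq_mk.2 ⟨0, ?_, ?_⟩
      · refine Matrix.ext fun i j => ?_
        change _ = (p : Unitization ℂ A).fst
        rw [Unitization.fst_inr]
        rfl
      · refine Matrix.ext fun i j => i.elim0
    rw [K00.mk, this, map_zero]⟩

end NonUnital

end KTheory

/-! ## The class of the unit -/

section Unit

variable (D : Type*) [MetricSpace D] [DiscreteTopology D]

lemma isStarProjection_uniformRoeOne : IsStarProjection (uniformRoeOne D) :=
  ⟨Subtype.ext (mul_one _), Subtype.ext (star_one _)⟩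

/-- The class `[1]` of the unit in `K₀` of the uniform Roe algebra. -/
def unitClass : K0 (RoeAlg D ℂ) := K0.ofProj (isStarProjection_uniformRoeOne D)

end Unit

/-! ## Borel–Moore homology of graphs -/

section BorelMoore

variable {V : Type*}

/-- Borel–Moore `0`-chains: arbitrary formal sums `∑ λ_x x` over the vertices. -/
abbrev BMChain0 (_G : SimpleGraph V) : Type _ := V → ℤ

/-- Borel–Moore `1`-chains: arbitrary formal sums `∑ λ_e e` over the edges. -/
abbrev BMChain1 (G : SimpleGraph V) : Type _ := G.edgeSet → ℤ

open Classical in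
/-- The coefficient at the vertex `x` of the boundary of an edge: `∂e = (end of e) - (start of e)`.
The edge `e` is oriented by the chosen representative `e.out : V × V` of the unordered pair `e`. -/
def edgeBoundary (e : Sym2 V) (x : V) : ℤ :=
  (if e.out.2 = x then 1 else 0) - (if e.out.1 = x then 1 else 0)

lemma mem_of_edgeBoundary_ne_zero {e : Sym2 V} {x : V} (h : edgeBoundary e x ≠ 0) : x ∈ e := by
  have he : s(e.out.1, e.out.2) = e := Quot.out_eq e
  rw [← he, Sym2.mem_iff]
  by_contra! hx
  exact h (by simp [edgeBoundary, hx.1.symm, hx.2.symm])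

lemma finite_edges_at (G : SimpleGraph V) [∀ x, Finite (G.neighborSet x)] (x : V) :
    {e : G.edgeSet | x ∈ (e : Sym2 V)}.Finite := by
  refine Set.Finite.of_finite_image (f := Subtype.val) ?_ Subtype.val_injective.injOn
  refine ((Set.toFinite (G.neighborSet x)).image (fun y => s(x, y))).subset ?_
  rintro _ ⟨⟨e, he⟩, hx, rfl⟩
  obtain ⟨y, rfl⟩ := hx
  exact ⟨y, he, rfl⟩

lemma finite_support_boundary (G : SimpleGraph V) [∀ x, Finite (G.neighborSet x)]
    (b : BMChain1 G) (x : V) :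
    (Function.support fun e : G.edgeSet => b e * edgeBoundary (e : Sym2 V) x).Finite :=
  (finite_edges_at G x).subset fun _ he =>
    mem_of_edgeBoundary_ne_zero (right_ne_zero_of_mul he)

/-- The boundary map `∂ : C₁^BM(G) → C₀^BM(G)` of a locally finite graph. The sum that gives the
coefficient of `∂b` at a vertex `x` has only finitely many nonzero terms, as only finitely many
edges meet `x`. -/
def bmBoundary (G : SimpleGraph V) [∀ x, Finite (G.neighborSet x)] : BMChain1 G →+ BMChain0 G where
  toFun b x := ∑ᶠ e : G.edgeSet, b e * edgeBoundary (e : Sym2 V) x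
  map_zero' := by ext x; simp
  map_add' b b' := by
    ext x
    simp only [Pi.add_apply, add_mul]
    exact finsum_add_distrib (finite_support_boundary G b x) (finite_support_boundary G b' x)

/-- The `0`-th Borel–Moore homology group `C₀^BM(G) / ∂ C₁^BM(G)` of a locally finite graph. -/
abbrev BMHomology0 (G : SimpleGraph V) [∀ x, Finite (G.neighborSet x)] : Type _ :=
  BMChain0 G ⧸ (bmBoundary G).range

/-- The class in `H₀^BM(G)` of the chain `c` with all coefficients equal to `1`. -/
def bmOnes (G : SimpleGraph V) [∀ x, Finite (G.neighborSet x)] : BMHomology0 G :=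
  QuotientAddGroup.mk (1 : V → ℤ)

lemma range_bmBoundary_mono {G G' : SimpleGraph V} [∀ x, Finite (G.neighborSet x)]
    [∀ x, Finite (G'.neighborSet x)] (h : G ≤ G') :
    (bmBoundary G).range ≤ (bmBoundary G').range := by
  classical
  rintro _ ⟨b, rfl⟩
  refine ⟨fun e => if he : (e : Sym2 V) ∈ G.edgeSet then b ⟨e, he⟩ else 0, ?_⟩
  ext x
  let ι : G.edgeSet → G'.edgeSet := Set.inclusion (SimpleGraph.edgeSet_mono h)
  have hι : Function.Injective ι := Set.inclusion_injective _
  let F : G'.edgeSet → ℤ := fun e =>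
    (if he : (e : Sym2 V) ∈ G.edgeSet then b ⟨e, he⟩ else 0) * edgeBoundary (e : Sym2 V) x
  change ∑ᶠ e : G'.edgeSet, F e = ∑ᶠ e : G.edgeSet, b e * edgeBoundary (e : Sym2 V) x
  have h1 : ∑ᶠ e : G'.edgeSet, F e = ∑ᶠ e ∈ Set.range ι, F e := by
    rw [← finsum_mem_univ]
    refine finsum_mem_inter_support_eq' F _ _ fun e he => ⟨fun _ => ?_, fun _ => trivial⟩
    by_contra hne
    refine he ?_
    have : (e : Sym2 V) ∉ G.edgeSet := fun h' => hne ⟨⟨e, h'⟩, rfl⟩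
    simp [F, this]
  rw [h1, finsum_mem_range hι]
  refine finsum_congr fun e => ?_
  simp [F, ι]

/-- The map `H₀^BM(G) → H₀^BM(G')` induced by the inclusion of a graph `G` in a graph `G'` with the
same vertices: it is the identity on vertices. -/
def bmMap {G G' : SimpleGraph V} [∀ x, Finite (G.neighborSet x)]
    [∀ x, Finite (G'.neighborSet x)] (h : G ≤ G') : BMHomology0 G →+ BMHomology0 G' :=
  QuotientAddGroup.map _ _ (AddMonoidHom.id (V → ℤ)) (range_bmBoundary_mono h)

end BorelMoore

section Rips

variable (D : Type*) [MetricSpace D]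

/-- The graph `D(α)`: its vertices are the points of `D`, and `x ≠ y` are joined by an edge
whenever `d(x, y) ≤ α`. -/
def ripsGraph (α : ℝ) : SimpleGraph D where
  Adj x y := x ≠ y ∧ dist x y ≤ α
  symm := ⟨fun x y h => ⟨h.1.symm, by rw [dist_comm]; exact h.2⟩⟩
  loopless := ⟨fun _ h => h.1 rfl⟩

lemma ripsGraph_mono {α β : ℝ} (h : α ≤ β) : ripsGraph D α ≤ ripsGraph D β :=
  fun _ _ hxy => ⟨hxy.1, hxy.2.trans h⟩

instance [HasBoundedGeometry D] (α : Set.Ioi (0 : ℝ)) (x : D) :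
    Finite ((ripsGraph D α).neighborSet x) := by
  obtain ⟨N, hN⟩ := HasBoundedGeometry.exists_encard_closedBall_le (D := D) α α.2
  refine (Set.finite_of_encard_le_coe (hN x)).subset fun y hy => ?_
  rw [Metric.mem_closedBall, dist_comm]
  exact hy.2

variable [HasBoundedGeometry D]

open Classical in
/-- The direct limit of the groups `H₀^BM(D(α))` over `α > 0`. -/
abbrev BMLimit : Type _ :=
  AddCommGroup.DirectLimit (fun α : Set.Ioi (0 : ℝ) => BMHomology0 (ripsGraph D α))
    fun _ _ h => bmMap (ripsGraph_mono D h)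

open Classical in
/-- The canonical map from `H₀^BM(D(α))` to the direct limit. -/
def toBMLimit (α : Set.Ioi (0 : ℝ)) : BMHomology0 (ripsGraph D α) →+ BMLimit D :=
  AddCommGroup.DirectLimit.of (fun α : Set.Ioi (0 : ℝ) => BMHomology0 (ripsGraph D α))
    (fun _ _ h => bmMap (ripsGraph_mono D h)) α

/-- The class of `c` in the direct limit can be computed at any `α`. -/
lemma toBMLimit_bmOnes (α β : Set.Ioi (0 : ℝ)) :
    toBMLimit D α (bmOnes (ripsGraph D α)) = toBMLimit D β (bmOnes (ripsGraph D β)) := by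
  classical
  have key : ∀ α β : Set.Ioi (0 : ℝ), α ≤ β →
      toBMLimit D α (bmOnes (ripsGraph D α)) = toBMLimit D β (bmOnes (ripsGraph D β)) :=
    fun α β h => (AddCommGroup.DirectLimit.of_f
      (G := fun α : Set.Ioi (0 : ℝ) => BMHomology0 (ripsGraph D α))
      (f := fun _ _ h => bmMap (ripsGraph_mono D h)) h (bmOnes (ripsGraph D α))).symm
  rcases le_total α β with h | h
  · exact key α β h
  · exact (key β α h).symm

end Rips

end CoarseK

end

noncomputable section

namespace CoarseK

/-! ## Maps escaping to infinity -/

section Escape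

variable {V : Type*}

/-! Both vanishing statements are governed by one alternative about the large-scale geometry of `D`,
proved in `pointsEscape_or_hasIsolatedFinsets`. Either some graph `D(β)` has the property that every
nonempty finite set of vertices has an edge leaving it, or there are nonempty finite sets
arbitrarily far from their complements.

In the first case `exists_escape` gives a self-map `φ` that moves every point along an edge, with
only finitely many pairs `(x, k)` such that `φ^k x = y`. Each point then sends a ray to infinity.
The sum of these rays is a locally finite `1`-chain that bounds `c` up to sign
(`ones_mem_range_bmBoundary`). The same rays drive an Eilenberg swindle in the Roe algebra
(`exists_absorbing_operators`). Over each `φ^k x` choose a unit vector, all of them orthonormal,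
which is possible because `H` is infinite-dimensional. Let `q` be the projection onto their span.
Shifting every ray by one step frees the vectors with `k = 0`, so `i_D(1) ⊕ q` is equivalent to `q`,
and the class of `i_D(1)` is zero.

In the second case both classes are nonzero. If `C` is finite and has no edges of `D(β)` to its
complement, a boundary in `D(β)` has total coefficient `0` on `C`, while `c` has total `|C| > 0`
(`sum_bmBoundary_eq_zero`). For K-theory, a vanishing class yields an isometry `Z` from `p ⊕ 1` to
`1` over matrices of scalars plus Roe operators, with `p = i_D(1)`
(`exists_isometry_of_ofProj_eq_zero`). The Roe parts are nearly of finite propagation, hence nearly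
commute with the characteristic function of a sufficiently isolated `C`. Local compactness then
yields a projection `F` of finite rank that nearly commutes with all entries and fixes a nonzero
vector of `p` (`exists_almost_commuting_projection`). Compressing `Z` by `F` embeds a space of
dimension `1 + k·rank F` into one of dimension `k·rank F`, which is absurd
(`exists_commutator_gap`). -/

lemma finite_orbits_of_acc {φ : V → V} (hφ : ∀ y, {x | φ x = y}.Finite) {y : V}
    (hy : Acc (fun x y => φ x = y) y) : {p : V × ℕ | φ^[p.2] p.1 = y}.Finite := by
  induction hy with
  | intro y _ ih =>
    refine ((Set.finite_singleton (y, 0)).union ((hφ y).biUnion fun z hz =>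
      (ih z hz).image fun p : V × ℕ => (p.1, p.2 + 1))).subset ?_
    rintro ⟨x, k⟩ hp
    cases k with
    | zero => exact Or.inl (by simpa using hp)
    | succ k =>
      -- An orbit that reaches `y` after `k + 1` steps passes through a preimage of `y` after `k`
      -- steps.
      refine Or.inr (Set.mem_biUnion (x := φ^[k] x) ?_ ⟨(x, k), rfl, rfl⟩)
      exact (Function.iterate_succ_apply' φ k x).symm.trans hp

/-- A form of König's lemma: a finitely branching tree without infinite branches is finite. -/
lemma finite_descendants_of_acc {r : V → V → Prop} (hr : ∀ y, {x | r x y}.Finite) {y : V}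
    (hy : Acc r y) : {x | Relation.ReflTransGen r x y}.Finite := by
  induction hy with
  | intro y _ ih =>
    refine ((Set.finite_singleton y).union ((hr y).biUnion fun z hz => ih z hz)).subset ?_
    intro x hx
    rcases Relation.ReflTransGen.cases_tail hx with h | ⟨z, hxz, hzy⟩
    · exact Or.inl h.symm
    · exact Or.inr (Set.mem_biUnion (x := z) hzy hxz)

/-- The vertex `z` is the second one on a geodesic from `x` to `r`. It supplies the parents in a
geodesic spanning tree. -/
lemma exists_adj_dist_eq {G : SimpleGraph V} {x r : V} (h : G.Reachable x r)
    (h0 : G.dist x r ≠ 0) : ∃ z, G.Adj x z ∧ G.dist x r = G.dist z r + 1 := by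
  obtain ⟨p, hp⟩ := h.exists_walk_length_eq_dist
  cases p with
  | nil => exact absurd hp.symm h0
  | @cons _ z _ hz q =>
    refine ⟨z, hz, ?_⟩
    have h1 := SimpleGraph.dist_le q
    rw [SimpleGraph.Walk.length_cons] at hp
    have h2 := hz.symm.diff_dist_adj (u := r)
    rw [SimpleGraph.dist_comm (u := r), SimpleGraph.dist_comm (u := r)] at h2
    omega

/-- In a locally finite graph without finite components, the vertices can be moved to infinity
along edges such that only finitely many orbits pass through each vertex. -/
theorem exists_escape (G : SimpleGraph V) [∀ x, Finite (G.neighborSet x)]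
    (hG : ∀ C : Set V, C.Finite → C.Nonempty → ∃ x ∈ C, ∃ y ∉ C, G.Adj x y) :
    ∃ φ : V → V, (∀ x, G.Adj x (φ x)) ∧ ∀ y, {p : V × ℕ | φ^[p.2] p.1 = y}.Finite := by
  classical
  -- Each component gets a root `r x`. With `ρ` the distance to the root and `π` a neighbour nearer
  -- to it, this is a spanning forest.
  let r : V → V := fun x => (G.connectedComponentMk x).out
  have hr : ∀ x, G.Reachable (r x) x := fun x =>
    SimpleGraph.ConnectedComponent.exact (Quot.out_eq (G.connectedComponentMk x))
  have hadj : ∀ {x y}, G.Adj x y → r x = r y := fun h =>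
    congrArg Quot.out (SimpleGraph.ConnectedComponent.sound h.reachable)
  let ρ : V → ℕ := fun x => G.dist (r x) x
  have hρ0 : ∀ x, ρ x = 0 → x = r x := fun x h => ((hr x).dist_eq_zero_iff.1 h).symm
  have hpar : ∀ x, ρ x ≠ 0 → ∃ z, G.Adj x z ∧ ρ x = ρ z + 1 := by
    intro x hx
    obtain ⟨z, hz, h⟩ := exists_adj_dist_eq (hr x).symm (by rwa [SimpleGraph.dist_comm])
    refine ⟨z, hz, ?_⟩
    change G.dist (r x) x = G.dist (r z) z + 1
    rw [SimpleGraph.dist_comm, h, ← hadj hz, SimpleGraph.dist_comm]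
  choose! π hπ hπρ using hpar
  -- `c x y` means that `x` is a child of `y`. As branching is finite, accessible vertices are those
  -- with finitely many descendants.
  let c : V → V → Prop := fun x y => ρ x ≠ 0 ∧ π x = y
  have hc : ∀ {x y}, c x y → G.Adj x y ∧ ρ x = ρ y + 1 := by
    rintro x _ ⟨h, rfl⟩
    exact ⟨hπ x h, hπρ x h⟩
  have hcfin : ∀ y, {x | c x y}.Finite := fun y =>
    (Set.toFinite (G.neighborSet y)).subset fun x hx => (hc hx).1.symm
  -- All vertices of a component descend from its root, so an accessible root would make the
  -- component finite, with no edge leaving it.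
  have hroot : ∀ x, ρ x = 0 → ¬ Acc c x := by
    intro x hx hacc
    have hd : ∀ n z, ρ z = n → r z = r x → Relation.ReflTransGen c z x := by
      intro n
      induction n with
      | zero =>
        intro z hz hzx
        rw [hρ0 z hz, hzx, ← hρ0 x hx]
      | succ n ih =>
        intro z hz hzx
        have h0 : ρ z ≠ 0 := by omega
        refine Relation.ReflTransGen.head ⟨h0, rfl⟩ (ih (π z) ?_ ?_)
        · have := hπρ z h0
          omega
        · rw [← hadj (hπ z h0), hzx]
    obtain ⟨z, hz, w, hw, hzw⟩ := hG {z | r z = r x}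
      ((finite_descendants_of_acc hcfin hacc).subset fun z hz => hd _ z rfl hz) ⟨x, rfl⟩
    exact hw ((hadj hzw).symm.trans hz)
  have hchild : ∀ y, ¬ Acc c y → ∃ x, c x y ∧ ¬ Acc c x := by
    intro y hy
    by_contra! h
    exact hy ⟨y, h⟩
  choose! σ hσ hσ' using hchild
  -- Vertices with a finite subtree climb towards the root. The others descend to a child whose
  -- subtree is again infinite, and then descend forever.
  let φ : V → V := fun x => if Acc c x then π x else σ x
  have hφp : ∀ {x}, Acc c x → c x (φ x) := fun {x} h =>
    ⟨fun h0 => hroot x h0 h, (if_pos h).symm⟩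
  have hφn : ∀ {x}, ¬ Acc c x → c (φ x) x ∧ ¬ Acc c (φ x) := fun {x} h => by
    rw [show φ x = σ x from if_neg h]
    exact ⟨hσ x h, hσ' x h⟩
  have hφ : ∀ x, G.Adj x (φ x) := fun x => by
    by_cases h : Acc c x
    · exact (hc (hφp h)).1
    · exact (hc (hφn h).1).1.symm
  refine ⟨φ, hφ, fun y => finite_orbits_of_acc
    (fun y => (Set.toFinite (G.neighborSet y)).subset ?_) ?_⟩
  · rintro x rfl
    exact (hφ x).symm
  -- An accessible vertex is reached only from accessible children, so its backward orbits stay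
  -- inside its subtree.
  have hacc1 : ∀ y, Acc c y → Acc (fun x y => φ x = y) y := by
    intro y hy
    induction hy with
    | intro y hy ih =>
      refine ⟨y, ?_⟩
      rintro x rfl
      by_cases h : Acc c x
      · exact ih x (hφp h)
      · exact absurd ⟨_, hy⟩ (hφn h).2
  -- A preimage of any vertex is either accessible, and settled by `hacc1`, or its parent, where `ρ`
  -- is smaller. Hence the induction on `ρ`.
  have hacc2 : ∀ n y, ρ y = n → Acc (fun x y => φ x = y) y := by
    intro n
    induction n with
    | zero =>
      intro y hy
      refine ⟨y, ?_⟩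
      rintro x rfl
      by_cases h : Acc c x
      · exact hacc1 x h
      · have := (hc (hφn h).1).2
        omega
    | succ n ih =>
      intro y hy
      refine ⟨y, ?_⟩
      rintro x rfl
      by_cases h : Acc c x
      · exact hacc1 x h
      · have := (hc (hφn h).1).2
        exact ih x (by omega)
  exact hacc2 _ y rfl

end Escape

/-! ## Boundaries of Borel–Moore chains -/

section Boundary

variable {V : Type*} (G : SimpleGraph V) [∀ x, Finite (G.neighborSet x)]

/-- The boundary of the chain with coefficients `a x y` (antisymmetric) on the edges. -/
lemma bmBoundary_antisymm (a : V → V → ℤ) (ha : ∀ x y, a x y = - a y x) (y : V) :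
    bmBoundary G (fun e => a (e : Sym2 V).out.1 (e : Sym2 V).out.2) y =
      ∑ᶠ z : G.neighborSet y, a z y := by
  classical
  change ∑ᶠ e : G.edgeSet, a (e : Sym2 V).out.1 (e : Sym2 V).out.2 * edgeBoundary (e : Sym2 V) y = _
  let ι : G.neighborSet y → G.edgeSet := fun z => ⟨s(y, z), z.2⟩
  have hι : Function.Injective ι := fun z w h => by
    have : s(y, (z : V)) = s(y, (w : V)) := congrArg Subtype.val h
    exact Subtype.ext (Sym2.congr_right.1 this)
  rw [← finsum_mem_univ, finsum_mem_inter_support_eq' (t := Set.range ι), finsum_mem_range hι]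
  · refine finsum_congr fun z => ?_
    have hne : y ≠ z := G.ne_of_adj z.2
    have he : s((s(y, (z : V))).out.1, (s(y, (z : V))).out.2) = s(y, (z : V)) := Quot.out_eq _
    change a (s(y, (z : V))).out.1 (s(y, (z : V))).out.2 * edgeBoundary (s(y, (z : V))) y = _
    unfold edgeBoundary
    -- The chosen representative may orient the edge either way. Antisymmetry of `a` makes both
    -- contributions equal.
    rcases Sym2.eq_iff.1 he with ⟨h1, h2⟩ | ⟨h1, h2⟩
    · rw [h1, h2, if_neg hne.symm, if_pos rfl, ha]; ring
    · rw [h1, h2, if_neg hne.symm, if_pos rfl]; ring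
  · intro e he
    refine ⟨fun _ => ?_, fun _ => trivial⟩
    obtain ⟨z, hz⟩ := mem_of_edgeBoundary_ne_zero (right_ne_zero_of_mul he)
    have hadj : G.Adj y z := by
      have := e.2
      rwa [hz] at this
    exact ⟨⟨z, hadj⟩, Subtype.ext hz.symm⟩

/-- If points escape to infinity along the edges of a graph, then the chain with all coefficients
equal to `1` is a boundary. -/
lemma ones_mem_range_bmBoundary {φ : V → V} (hφ : ∀ x, G.Adj x (φ x))
    (hfin : ∀ y, {p : V × ℕ | φ^[p.2] p.1 = y}.Finite) :
    (1 : V → ℤ) ∈ (bmBoundary G).range := by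
  classical
  -- `n y` counts the visits of all rays to `y`: one from the ray that starts there, the others
  -- arriving from preimages of `y`.
  let n : V → ℤ := fun y => (hfin y).toFinset.card
  have hφfin : ∀ y, {x | φ x = y}.Finite := fun y =>
    (Set.toFinite (G.neighborSet y)).subset fun x hx => by
      have : φ x = y := hx
      exact this ▸ (hφ x).symm
  have hn : ∀ y, n y = 1 + ∑ z ∈ (hφfin y).toFinset, n z := by
    intro y
    have h1 : (hfin y).toFinset = {(y, 0)} ∪ (hφfin y).toFinset.biUnion fun z =>
        (hfin z).toFinset.image fun p : V × ℕ => (p.1, p.2 + 1) := by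
      ext ⟨x, k⟩
      cases k with
      | zero => simp
      | succ k => simp [Function.iterate_succ_apply', -Function.iterate_succ]
    have h2 : (hfin y).toFinset.card = 1 + ∑ z ∈ (hφfin y).toFinset, (hfin z).toFinset.card := by
      rw [h1, Finset.card_union_of_disjoint, Finset.card_singleton, Finset.card_biUnion]
      · congr 1
        refine Finset.sum_congr rfl fun z _ => Finset.card_image_of_injective _ ?_
        rintro ⟨x, k⟩ ⟨x', k'⟩ h
        simpa using h
      · intro z _ w _ hzw
        refine Finset.disjoint_left.2 ?_
        rintro ⟨x, k⟩ hx hx'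
        simp only [Finset.mem_image, Set.Finite.mem_toFinset, Set.mem_ofPred_eq, Prod.exists,
          Prod.mk.injEq] at hx hx'
        obtain ⟨_, k1, h1, rfl, rfl⟩ := hx
        obtain ⟨_, k2, h2, rfl, h3⟩ := hx'
        obtain rfl : k2 = k1 := by omega
        exact hzw (h1.symm.trans h2)
      · simp
    change ((hfin y).toFinset.card : ℤ) = _
    rw [h2]
    push_cast
    rfl
  -- The edge from `x` to `φ x` carries `-n x`. With this sign the boundary is outflow minus inflow,
  -- which is `1` by `hn`.
  let a : V → V → ℤ := fun x y => (if φ y = x then n y else 0) - (if φ x = y then n x else 0)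
  refine ⟨_, funext fun y => (bmBoundary_antisymm G a (fun x y => by simp [a]) y).trans ?_⟩
  have : Fintype (G.neighborSet y) := Fintype.ofFinite _
  have h1 : ∑ z : G.neighborSet y, (if φ y = (z : V) then n y else 0) = n y := by
    rw [Finset.sum_eq_single ⟨φ y, hφ y⟩]
    · simp
    · rintro z - hz
      exact if_neg fun h => hz (Subtype.ext h.symm)
    · simp
  have h2 : ∑ z : G.neighborSet y, (if φ z = y then n z else 0) =
      ∑ z ∈ (hφfin y).toFinset, n z := by
    rw [← Finset.sum_filter]
    refine Finset.sum_bij (fun z _ => (z : V)) ?_ ?_ ?_ ?_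
    · intro z hz; simpa using hz
    · intro z _ w _ h; exact Subtype.ext h
    · intro z hz
      have hz' : φ z = y := by simpa using hz
      exact ⟨⟨z, hz' ▸ (hφ z).symm⟩, by simpa using hz', rfl⟩
    · intros; rfl
  rw [finsum_eq_sum_of_fintype, Finset.sum_sub_distrib, h1, h2]
  have := hn y
  change n y - _ = 1
  omega

/-- The coefficients of a boundary add up to `0` over each finite union of components. -/
lemma sum_bmBoundary_eq_zero {C : Finset V} (hC : ∀ x ∈ C, ∀ y, G.Adj x y → y ∈ C)
    (b : BMChain1 G) : ∑ x ∈ C, bmBoundary G b x = 0 := by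
  classical
  change ∑ x ∈ C, ∑ᶠ e : G.edgeSet, b e * edgeBoundary (e : Sym2 V) x = 0
  -- After the interchange each edge contributes `0`, since it has both ends in `C` or neither.
  rw [← finsum_sum_comm _ _ fun x _ => finite_support_boundary G b x]
  refine (finsum_congr fun e => ?_).trans finsum_zero
  rw [← Finset.mul_sum]
  have he : G.Adj (e : Sym2 V).out.1 (e : Sym2 V).out.2 := by
    have h : s((e : Sym2 V).out.1, (e : Sym2 V).out.2) = e := Quot.out_eq _
    have := e.2
    rwa [← h] at this
  have hiff : (e : Sym2 V).out.1 ∈ C ↔ (e : Sym2 V).out.2 ∈ C :=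
    ⟨fun h => hC _ h _ he, fun h => hC _ h _ he.symm⟩
  simp only [edgeBoundary, Finset.sum_sub_distrib, Finset.sum_ite_eq, hiff, sub_self, mul_zero]

end Boundary

/-! ## Spaces whose points escape to infinity -/

section Space

variable (D : Type*) [MetricSpace D]

/-- The points of `D` can be moved to infinity by steps of bounded length, with finitely many
orbits through each point. -/
def PointsEscape : Prop :=
  ∃ β : ℝ, 0 < β ∧ ∃ φ : D → D, (∀ x, (ripsGraph D β).Adj x (φ x)) ∧
    ∀ y, {p : D × ℕ | φ^[p.2] p.1 = y}.Finite

/-- `D` has finite subsets that are arbitrarily far from their complements. -/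
def HasIsolatedFinsets : Prop :=
  ∀ β : ℝ, 0 < β → ∃ C : Finset D, C.Nonempty ∧ ∀ x ∈ C, ∀ y ∉ C, β < dist x y

variable {D} [HasBoundedGeometry D]

/-- If isolated finite sets fail to exist at scale `β`, then every nonempty finite set has an edge
of `D(β)` leaving it, which is the hypothesis of `exists_escape`. -/
lemma pointsEscape_or_hasIsolatedFinsets : PointsEscape D ∨ HasIsolatedFinsets D := by
  refine or_iff_not_imp_right.2 fun h => ?_
  unfold HasIsolatedFinsets at h
  push Not at h
  obtain ⟨β, hβ, h⟩ := h
  lift β to Set.Ioi (0 : ℝ) using hβ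
  refine ⟨β, β.2, exists_escape _ fun C hC hne => ?_⟩
  obtain ⟨x, hx, y, hy, hxy⟩ := h hC.toFinset (by simpa using hne)
  rw [Set.Finite.mem_toFinset] at hx hy
  exact ⟨x, hx, y, hy, fun h => hy (h ▸ hx), hxy⟩

lemma bmOnes_eq_zero_of_pointsEscape (h : PointsEscape D) (α : Set.Ioi (0 : ℝ)) :
    toBMLimit D α (bmOnes (ripsGraph D α)) = 0 := by
  obtain ⟨β, hβ, φ, hφ, hfin⟩ := h
  lift β to Set.Ioi (0 : ℝ) using hβ
  rw [toBMLimit_bmOnes D α β, bmOnes, (QuotientAddGroup.eq_zero_iff _).2, map_zero]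
  exact ones_mem_range_bmBoundary _ hφ hfin

lemma bmOnes_ne_zero_of_hasIsolatedFinsets (h : HasIsolatedFinsets D) (α : Set.Ioi (0 : ℝ)) :
    toBMLimit D α (bmOnes (ripsGraph D α)) ≠ 0 := by
  classical
  intro h0
  have : DirectedSystem (fun α : Set.Ioi (0 : ℝ) => BMHomology0 (ripsGraph D α))
      fun _ _ h => bmMap (ripsGraph_mono D h) :=
    ⟨fun i x => by obtain ⟨x, rfl⟩ := QuotientAddGroup.mk_surjective x; rfl,
      fun i j k _ _ x => by obtain ⟨x, rfl⟩ := QuotientAddGroup.mk_surjective x; rfl⟩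
  obtain ⟨β, hβ, hb⟩ := AddCommGroup.DirectLimit.of.zero_exact _ _ h0
  -- A zero class in the limit is already zero at some stage `β`. The transition maps are the
  -- identity on chains, so they preserve `c`.
  have hb' : bmOnes (ripsGraph D β) = 0 := hb
  obtain ⟨b, hb⟩ := (QuotientAddGroup.eq_zero_iff _).1 hb'
  obtain ⟨C, ⟨x, hx⟩, hC⟩ := h β β.2
  have := sum_bmBoundary_eq_zero (ripsGraph D β) (C := C) (fun x hx y hxy => by
    by_contra hy
    exact absurd (hC x hx y hy) (not_lt.2 hxy.2)) b
  rw [hb] at this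
  simp at this
  simp [this] at hx

end Space

/-! ## Vanishing of `K₀`-classes -/

section KZero

open Matrix

variable {A : Type*} [NonUnitalRing A] [StarRing A] [Module ℂ A] [IsScalarTower ℂ A A]
  [SMulCommClass ℂ A A] [StarModule ℂ A]
  {B : Type*} [NonUnitalRing B] [StarRing B] [Module ℂ B] [IsScalarTower ℂ B B]
  [SMulCommClass ℂ B B] [StarModule ℂ B]

lemma K0.map_ofProj (φ : A →⋆ₙₐ[ℂ] B) {p : A} (hp : IsStarProjection p)
    (hφp : IsStarProjection (φ p)) : K0.map φ (K0.ofProj hp) = K0.ofProj hφp := by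
  refine Subtype.ext ?_
  change K00.map (Unitization.starMap φ) (K00.mk (projMat hp)) = K00.mk (projMat hφp)
  rw [K00.map_mk]
  congr 1
  unfold MatProj.map projMat
  congr 1
  refine Matrix.ext fun i j => ?_
  change Unitization.starMap φ (p : Unitization ℂ A) = (φ p : Unitization ℂ B)
  simp

/-- Two elements of a monoid agree in its Grothendieck group when they agree after adding a common
element. That element is `q`. -/
lemma K00.mk_eq_zero_iff {R : Type*} [Ring R] [StarRing R] (p : MatProj R) :
    K00.mk p = 0 ↔ ∃ q : MatProj R, MvN (fromBlocks p.mat 0 0 q.mat) q.mat := by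
  have key : ∀ q : MatProj R, ProjMonoid.mk p + ProjMonoid.mk q = ProjMonoid.mk q ↔
      MvN (fromBlocks p.mat 0 0 q.mat) q.mat := fun q => by
    rw [ProjMonoid.mk_add_mk, ProjMonoid.mk_eq_mk]
    exact ⟨(p.add_mat q).trans (isStarProjection_fromBlocks p.isProj q.isProj) q.isProj,
      (p.add_mat q).symm.trans (p.add q).isProj q.isProj⟩
  constructor
  · intro h
    rw [← map_zero (Algebra.GrothendieckAddGroup.of (M := ProjMonoid R))] at h
    obtain ⟨⟨⟨q⟩, _⟩, hq⟩ := (AddLocalization.addMonoidOf ⊤).eq_iff_exists.1 h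
    refine ⟨q, (key q).1 ?_⟩
    rw [add_comm]
    exact hq.trans (add_zero _)
  · rintro ⟨q, hq⟩
    have h := congrArg Algebra.GrothendieckAddGroup.of ((key q).2 hq)
    rw [map_add] at h
    exact add_eq_right.1 h

lemma K0.ofProj_eq_zero_iff {p : A} (hp : IsStarProjection p) :
    K0.ofProj hp = 0 ↔ ∃ q : MatProj (Unitization ℂ A),
      MvN (fromBlocks (projMat hp).mat 0 0 q.mat) q.mat :=
  Subtype.ext_iff.trans (K00.mk_eq_zero_iff _)

/-- The row `(v w)` implements the equivalence. Its cross terms vanish by `h3`. -/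
lemma mvN_fromBlocks_of_absorbed {R : Type*} [Ring R] [StarRing R] {p q v w : R}
    (h1 : star v * v = p) (h2 : star w * w = q) (h3 : star v * w = 0)
    (h4 : v * star v + w * star w = q) :
    MvN (fromBlocks (Matrix.of fun _ _ : Fin 1 => p) 0 0 (Matrix.of fun _ _ : Fin 1 => q))
      (Matrix.of fun _ _ : Fin 1 => q) := by
  have h3' : star w * v = 0 := by simpa using congrArg star h3
  refine ⟨Matrix.of fun _ j => Sum.elim (fun _ => v) (fun _ => w) j, ?_, ?_⟩
  · refine Matrix.ext fun i j => ?_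
    rcases i with i | i <;> rcases j with j | j <;> simp [Matrix.mul_apply, h1, h2, h3, h3']
  · refine Matrix.ext fun i j => ?_
    simp [Matrix.mul_apply, h4]

lemma K0.ofProj_eq_zero_of_absorbed {p q v w : A} (hp : IsStarProjection p)
    (hq : IsStarProjection q) (h1 : star v * v = p) (h2 : star w * w = q) (h3 : star v * w = 0)
    (h4 : v * star v + w * star w = q) : K0.ofProj hp = 0 := by
  refine (K0.ofProj_eq_zero_iff hp).2 ⟨projMat hq, ?_⟩
  refine mvN_fromBlocks_of_absorbed (v := (v : Unitization ℂ A)) (w := (w : Unitization ℂ A))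
    ?_ ?_ ?_ ?_
  · rw [← Unitization.inr_star, ← Unitization.inr_mul, h1]
  · rw [← Unitization.inr_star, ← Unitization.inr_mul, h2]
  · rw [← Unitization.inr_star, ← Unitization.inr_mul, h3, Unitization.inr_zero]
  · rw [← Unitization.inr_star, ← Unitization.inr_star, ← Unitization.inr_mul,
      ← Unitization.inr_mul, ← Unitization.inr_add, h4]

/-- Allows the absorption identities to be checked for operators on the Hilbert space, without
subtypes. -/
lemma K0.ofProj_eq_zero_of_absorbed_coe {R : Type*} [Ring R] [StarRing R] [Algebra ℂ R]
    [StarModule ℂ R] {S : NonUnitalStarSubalgebra ℂ R} {p : S} (hp : IsStarProjection p)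
    (h : ∃ q ∈ S, ∃ v ∈ S, ∃ w ∈ S, q * q = q ∧ star v * v = p ∧ star w * w = q ∧
      star v * w = 0 ∧ v * star v + w * star w = q) : K0.ofProj hp = 0 := by
  obtain ⟨q, hqS, v, hvS, w, hwS, h0, h1, h2, h3, h4⟩ := h
  have hq : star q = q := by rw [← h2, star_mul, star_star]
  exact K0.ofProj_eq_zero_of_absorbed (q := ⟨q, hqS⟩) (v := ⟨v, hvS⟩) (w := ⟨w, hwS⟩) hp
    ⟨Subtype.ext h0, Subtype.ext hq⟩ (Subtype.ext h1) (Subtype.ext h2) (Subtype.ext h3)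
    (Subtype.ext h4)

end KZero

/-! ## Isometries given by orthonormal families -/

section Orthonormal

variable {I E : Type*} [NormedAddCommGroup E] [InnerProductSpace ℂ E]

lemma clm_ext_single [DecidableEq I] {A B : L2 I ℂ →L[ℂ] E}
    (h : ∀ i, A (lp.single 2 i 1) = B (lp.single 2 i 1)) : A = B := by
  ext v
  have hv := lp.hasSum_single (by norm_num) v
  refine (hv.mapL A).unique ?_
  convert hv.mapL B using 2 with i
  have hi : (lp.single 2 i (v i) : L2 I ℂ) = v i • lp.single 2 i 1 := by
    rw [← lp.single_smul, smul_eq_mul, mul_one]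
  change A (lp.single 2 i (v i)) = B (lp.single 2 i (v i))
  rw [hi, map_smul, map_smul, h]

variable [CompleteSpace E] {w : I → E}

/-- The isometry `ℓ²(I) → E` that maps the standard basis to an orthonormal family. -/
def isoOf (hw : Orthonormal ℂ w) : L2 I ℂ →ₗᵢ[ℂ] E := hw.orthogonalFamily.linearIsometry

lemma isoOf_single [DecidableEq I] (hw : Orthonormal ℂ w) (i : I) :
    isoOf hw (lp.single 2 i 1) = w i := by
  rw [isoOf, OrthogonalFamily.linearIsometry_apply_single]
  simp

lemma adjoint_apply_coord [DecidableEq I] (A : L2 I ℂ →L[ℂ] E) (v : E) (i : I) :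
    ContinuousLinearMap.adjoint A v i = inner ℂ (A (lp.single 2 i 1)) v := by
  rw [← ContinuousLinearMap.adjoint_inner_right, lp.inner_single_left]
  simp

lemma adjoint_isoOf_apply (hw : Orthonormal ℂ w) (v : E) (i : I) :
    ContinuousLinearMap.adjoint (isoOf hw).toContinuousLinearMap v i = inner ℂ (w i) v := by
  classical
  rw [adjoint_apply_coord]
  exact congrArg (inner ℂ · v) (isoOf_single hw i)

lemma hasSum_isoOf_adjoint (hw : Orthonormal ℂ w) (v : E) :
    HasSum (fun i => inner ℂ (w i) v • w i)
      (isoOf hw (ContinuousLinearMap.adjoint (isoOf hw).toContinuousLinearMap v)) := by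
  have h := hw.orthogonalFamily.hasSum_linearIsometry
    (ContinuousLinearMap.adjoint (isoOf hw).toContinuousLinearMap v)
  simp only [LinearIsometry.toSpanSingleton_apply, adjoint_isoOf_apply] at h
  exact h

lemma adjoint_isoOf_comp_eq_zero {J : Type*} {w' : J → E} (hw : Orthonormal ℂ w)
    (hw' : Orthonormal ℂ w') (h : ∀ i j, inner ℂ (w i) (w' j) = 0) (v : L2 J ℂ) :
    ContinuousLinearMap.adjoint (isoOf hw).toContinuousLinearMap (isoOf hw' v) = 0 := by
  classical
  have : ContinuousLinearMap.adjoint (isoOf hw).toContinuousLinearMap ∘L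
      (isoOf hw').toContinuousLinearMap = 0 := by
    refine clm_ext_single fun j => ?_
    ext i
    change ContinuousLinearMap.adjoint (isoOf hw).toContinuousLinearMap
      (isoOf hw' (lp.single 2 j 1)) i = 0
    rw [adjoint_isoOf_apply, isoOf_single, h]
  exact DFunLike.congr_fun this v

/-- `W W*` is the projection onto the closed span of the family. Splitting the index set splits the
sum of rank-one projections. -/
lemma isoOf_adjoint_add {J K : Type*} (e : J ⊕ K ≃ I) (hw : Orthonormal ℂ w)
    (hJ : Orthonormal ℂ fun j => w (e (Sum.inl j))) (hK : Orthonormal ℂ fun k => w (e (Sum.inr k)))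
    (v : E) :
    isoOf hJ (ContinuousLinearMap.adjoint (isoOf hJ).toContinuousLinearMap v) +
      isoOf hK (ContinuousLinearMap.adjoint (isoOf hK).toContinuousLinearMap v) =
      isoOf hw (ContinuousLinearMap.adjoint (isoOf hw).toContinuousLinearMap v) := by
  have h : HasSum ((fun i => inner ℂ (w i) v • w i) ∘ e) _ :=
    HasSum.sum (hasSum_isoOf_adjoint hJ v) (hasSum_isoOf_adjoint hK v)
  exact h.unique (e.hasSum_iff.2 (hasSum_isoOf_adjoint hw v))

lemma exists_orthonormal_nat (hE : ¬ FiniteDimensional ℂ E) : ∃ e : ℕ → E, Orthonormal ℂ e := by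
  obtain ⟨s, b, -⟩ := exists_hilbertBasis ℂ E
  have : Infinite s := by
    by_contra hs
    rw [not_infinite_iff_finite] at hs
    have := Fintype.ofFinite s
    exact hE b.toOrthonormalBasis.toBasis.finiteDimensional_of_finite
  exact ⟨_, b.orthonormal.comp (Infinite.natEmbedding s) (Infinite.natEmbedding s).injective⟩

end Orthonormal

/-! ## Elements of Roe algebras -/

section Elements

variable {D : Type*} [MetricSpace D] [DiscreteTopology D]
  {H : Type*} [NormedAddCommGroup H] [InnerProductSpace ℂ H] [CompleteSpace H]

lemma exists_norm_sub_restrictFinset_lt (f : C₀(D, ℂ)) {ε : ℝ} (hε : 0 < ε) :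
    ∃ F : Finset D, ‖f - restrictFinset f F‖ < ε := by
  have hfin : {x | ε / 2 ≤ ‖f x‖}.Finite := by
    have h := f.zero_at_infty'.norm
    rw [Filter.cocompact_eq_cofinite, norm_zero] at h
    have := h.eventually (gt_mem_nhds (half_pos hε))
    rw [Filter.eventually_cofinite] at this
    simpa using this
  refine ⟨hfin.toFinset, lt_of_le_of_lt ?_ (half_lt_self hε)⟩
  rw [← ZeroAtInftyContinuousMap.norm_toBCF_eq_norm,
    BoundedContinuousFunction.norm_le (half_pos hε).le]
  intro x
  change ‖f x - ((hfin.toFinset : Set D).indicator f) x‖ ≤ ε / 2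
  by_cases hx : x ∈ hfin.toFinset
  · rw [Set.indicator_of_mem hx, sub_self, norm_zero]
    positivity
  · rw [Set.indicator_of_notMem hx, sub_zero]
    simp only [Set.Finite.mem_toFinset, Set.mem_ofPred_eq, not_le] at hx
    exact hx.le

variable {I : Type*} [DecidableEq I] [DecidableEq D]

omit [DiscreteTopology D] in
lemma mulRep_single (f : C₀(D, ℂ)) (x : D) (h : H) :
    mulRep D H f (lp.single 2 x h) = f x • (lp.single 2 x h : L2 D H) := by
  ext y
  rw [mulRep_apply, lp.coeFn_smul, Pi.smul_apply]
  by_cases hy : y = x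
  · rw [hy]
  · rw [lp.single_apply_ne _ _ _ hy, smul_zero, smul_zero]

/-- Approximate `f` by functions of finite support. Only finitely many basis vectors are sent over a
finite set, so the cut-off operators have finite rank. -/
lemma isCompactOperator_mulRep_comp {A : L2 I ℂ →L[ℂ] L2 D H} {a : I → D} {h : I → H}
    (hA : ∀ i, A (lp.single 2 i 1) = lp.single 2 (a i) (h i)) (ha : ∀ y, {i | a i = y}.Finite)
    (f : C₀(D, ℂ)) : IsCompactOperator (mulRep D H f ∘L A) := by
  have hcl := isClosed_setOfPred_isCompactOperator (𝕜₁ := ℂ) (𝕜₂ := ℂ) (σ₁₂ := RingHom.id ℂ)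
    (M₁ := L2 I ℂ) (M₂ := L2 D H)
  suffices h : mulRep D H f ∘L A ∈ closure {T : L2 I ℂ →L[ℂ] L2 D H | IsCompactOperator T} from
    hcl.closure_subset h
  refine (Metric.mem_closure_iff (α := L2 I ℂ →L[ℂ] L2 D H)).2 fun ε hε => ?_
  obtain ⟨F, hF⟩ := exists_norm_sub_restrictFinset_lt f (ε := ε / (‖A‖ + 1)) (by positivity)
  refine ⟨mulRep D H (restrictFinset f F) ∘L A, ?_, ?_⟩
  · have hfin : {i | a i ∈ F}.Finite :=
      (F.finite_toSet.biUnion fun y _ => ha y).subset fun i hi => Set.mem_biUnion hi rfl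
    have heq : mulRep D H (restrictFinset f F) ∘L A = ∑ i ∈ hfin.toFinset,
        (mulRep D H (restrictFinset f F) ∘L A ∘L lp.singleContinuousLinearMap ℂ (fun _ : I => ℂ) 2 i)
          ∘L lp.evalCLM ℂ (fun _ : I => ℂ) 2 i := by
      refine clm_ext_single fun i => ?_
      rw [sum_apply]
      have hz : ∀ j, ((mulRep D H (restrictFinset f F) ∘L A ∘L
          lp.singleContinuousLinearMap ℂ (fun _ : I => ℂ) 2 j) ∘L
          lp.evalCLM ℂ (fun _ : I => ℂ) 2 j) (lp.single 2 i 1) =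
          if j = i then mulRep D H (restrictFinset f F) (A (lp.single 2 i 1)) else 0 := by
        intro j
        change mulRep D H (restrictFinset f F) (A (lp.single 2 j ((lp.single 2 i 1 : L2 I ℂ) j))) = _
        split_ifs with hj
        · rw [hj, lp.single_apply_self]
        · rw [lp.single_apply_ne _ _ _ hj, lp.single_zero, map_zero, map_zero]
      rw [Finset.sum_congr rfl fun j _ => hz j, Finset.sum_ite_eq']
      split_ifs with hi
      · rfl
      · change mulRep D H (restrictFinset f F) (A (lp.single 2 i 1)) = 0
        rw [hA, mulRep_single]
        have : restrictFinset (f : D → ℂ) F (a i) = 0 :=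
          Set.indicator_of_notMem (by simpa using hi) _
        rw [this, zero_smul]
    change IsCompactOperator (mulRep D H (restrictFinset f F) ∘L A)
    rw [heq]
    refine Submodule.sum_mem (compactOperator (RingHom.id ℂ) (L2 I ℂ) (L2 D H)) fun i _ => ?_
    exact IsCompactOperator.comp_clm (isCompactOperator_of_locallyCompactSpace_rng
      (mulRep D H (restrictFinset f F) ∘L A ∘L
        lp.singleContinuousLinearMap ℂ (fun _ : I => ℂ) 2 i)) (lp.evalCLM ℂ (fun _ : I => ℂ) 2 i)
  · refine (dist_eq_norm (mulRep D H f ∘L A) (mulRep D H (restrictFinset f F) ∘L A)).trans_lt ?_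
    rw [← ContinuousLinearMap.sub_comp, ← map_sub]
    refine (ContinuousLinearMap.opNorm_comp_le _ _).trans_lt ?_
    calc _ ≤ ε / (‖A‖ + 1) * ‖A‖ := by
          gcongr
          exact (norm_rep_le _ _).trans hF.le
      _ < ε := by
          rw [div_mul_eq_mul_div, div_lt_iff₀ (by positivity)]
          nlinarith

/-- Partial isometries and more general operators `A B*`, where `A` and `B` map the standard basis
to vectors over points that are at bounded distance. -/
lemma comp_adjoint_mem_roeAlg {A B : L2 I ℂ →L[ℂ] L2 D H} {a b : I → D} {h k : I → H}
    (hA : ∀ i, A (lp.single 2 i 1) = lp.single 2 (a i) (h i)) (ha : ∀ y, {i | a i = y}.Finite)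
    (hB : ∀ i, B (lp.single 2 i 1) = lp.single 2 (b i) (k i)) (hb : ∀ y, {i | b i = y}.Finite)
    {R : ℝ} (hR : 0 < R) (hab : ∀ i, dist (a i) (b i) ≤ R) :
    A ∘L ContinuousLinearMap.adjoint B ∈ RoeAlg D H := by
  refine NonUnitalStarSubalgebra.le_topologicalClosure _ ⟨fun f => ⟨?_, ?_⟩, R, hR, fun f g hfg => ?_⟩
  -- `A B* f` is the adjoint of `f̄ B A*`, which is compact by the previous lemma applied to `B`.
  · have h1 : IsCompactOperator (mulRep D H (star f) * (B ∘L ContinuousLinearMap.adjoint A)) :=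
      (isCompactOperator_mulRep_comp hB hb (star f)).comp_clm (ContinuousLinearMap.adjoint A)
    have h2 := isCompactOperator_adjoint h1
    rw [star_mul, ← map_star, star_star, ContinuousLinearMap.star_eq_adjoint,
      ContinuousLinearMap.adjoint_comp, ContinuousLinearMap.adjoint_adjoint] at h2
    exact h2
  · exact (isCompactOperator_mulRep_comp hA ha f).comp_clm (ContinuousLinearMap.adjoint B)
  · ext1 u
    set c := ContinuousLinearMap.adjoint B (mulRep D H g u) with hc
    change mulRep D H f (A c) = 0
    have hs := ((lp.hasSum_single (by norm_num) c).mapL (mulRep D H f ∘L A))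
    refine hs.unique ?_
    convert hasSum_zero using 2 with i
    have hi : (lp.single 2 i (c i) : L2 I ℂ) = c i • lp.single 2 i 1 := by
      rw [← lp.single_smul, smul_eq_mul, mul_one]
    change mulRep D H f (A (lp.single 2 i (c i))) = 0
    rw [hi, map_smul, map_smul, hA, mulRep_single, smul_smul]
    -- Every term thus carries the factor `f (a i) * g (b i)`, which vanishes because `a i` and `b
    -- i` are within `R`.
    have hci : c i = g (b i) * inner ℂ (k i) (u (b i)) := by
      rw [hc, adjoint_apply_coord, hB, lp.inner_single_left, mulRep_apply, inner_smul_right]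
    have hfg0 : f (a i) = 0 ∨ g (b i) = 0 := by
      by_contra! hne
      have := lt_dist_of_ofReal_lt_setDist hfg (x := a i) (y := b i)
        (subset_closure hne.1) (subset_closure hne.2)
      exact absurd (hab i) (not_le.2 this)
    rcases hfg0 with h0 | h0 <;> simp [hci, h0]

omit [MetricSpace D] [DiscreteTopology D] [CompleteSpace H] in
lemma isoD_single (V : ℂ →ₗᵢ[ℂ] H) (x : D) :
    isoD D V (lp.single 2 x 1) = lp.single 2 x (V 1) := by
  ext y
  change V ((lp.single 2 x 1 : L2 D ℂ) y) = _
  by_cases hy : y = x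
  · rw [hy, lp.single_apply_self, lp.single_apply_self]
  · rw [lp.single_apply_ne _ _ _ hy, lp.single_apply_ne _ _ _ hy, map_zero]

omit [MetricSpace D] [DiscreteTopology D] [DecidableEq I] in
/-- If finitely many indices lie over each point, then the standard vectors over these points can
be made orthonormal by means of an orthonormal sequence in `H`. -/
lemma exists_orthonormal_single (hH : ¬ FiniteDimensional ℂ H) {l : I → D}
    (hl : ∀ y, {i | l i = y}.Finite) :
    ∃ h : I → H, Orthonormal ℂ fun i => (lp.single 2 (l i) (h i) : L2 D H) := by
  obtain ⟨e, he⟩ := exists_orthonormal_nat hH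
  -- Vectors over different points are automatically orthogonal, so it is enough to number each
  -- fibre injectively.
  have hc : ∀ y, ∃ g : {i | l i = y} → ℕ, Function.Injective g := fun y =>
    have := (hl y).countable.to_subtype
    exists_injective_nat _
  choose g hg using hc
  refine ⟨fun i => e (g (l i) ⟨i, rfl⟩), ?_⟩
  have hne : ∀ {y : D} {i j : I} (hi : l i = y) (hj : l j = y), i ≠ j →
      g y ⟨i, hi⟩ ≠ g y ⟨j, hj⟩ := fun hi hj hij h => hij (congrArg Subtype.val (hg _ h))
  refine ⟨fun i => ?_, fun i j hij => ?_⟩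
  · rw [lp.norm_single (by norm_num)]
    exact he.1 _
  · change inner ℂ (lp.single 2 (l i) (e (g (l i) ⟨i, rfl⟩)) : L2 D H)
      (lp.single 2 (l j) (e (g (l j) ⟨j, rfl⟩))) = 0
    rw [lp.inner_single_left]
    by_cases h : l i = l j
    · have h1 : (lp.single 2 (l j) (e (g (l j) ⟨j, rfl⟩)) : L2 D H) (l i) =
          e (g (l j) ⟨j, rfl⟩) := by rw [h, lp.single_apply_self]
      have h2 : ∀ (y : D) (hy : l i = y), e (g (l i) ⟨i, rfl⟩) = e (g y ⟨i, hy⟩) := by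
        rintro _ rfl; rfl
      rw [h1, h2 _ h]
      exact he.2 (hne h rfl hij)
    · rw [lp.single_apply_ne _ _ _ h, inner_zero_right]

end Elements

/-! ## Vanishing of the class of the unit -/

section Vanishing

variable {D : Type*} [MetricSpace D] [DiscreteTopology D]
  {H : Type*} [NormedAddCommGroup H] [InnerProductSpace ℂ H] [CompleteSpace H]

variable (D) in
lemma isStarProjection_iD_one (V : ℂ →ₗᵢ[ℂ] H) : IsStarProjection (iD D V (uniformRoeOne D)) :=
  (isStarProjection_uniformRoeOne D).map (iD D V)

lemma iD_unitClass (V : ℂ →ₗᵢ[ℂ] H) :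
    K0.map (iD D V) (unitClass D) = K0.ofProj (isStarProjection_iD_one D V) :=
  K0.map_ofProj _ _ _

/-- The natural numbers, shifted, and the orbits that start at `0`. -/
def shiftEquiv (D : Type*) : D ⊕ D × ℕ ≃ D × ℕ where
  toFun := Sum.elim (fun x => (x, 0)) fun p => (p.1, p.2 + 1)
  invFun p := match p with
    | (x, 0) => Sum.inl x
    | (x, k + 1) => Sum.inr (x, k)
  left_inv := by rintro (x | ⟨x, k⟩) <;> rfl
  right_inv := by rintro ⟨x, _ | k⟩ <;> rfl

/-- The projection onto the span of the orbits of the basis vectors of `V_D ℓ²(D)`, with the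
isometries that move each orbit by one step and start it. -/
lemma exists_absorbing_operators (hH : ¬ FiniteDimensional ℂ H) (V : ℂ →ₗᵢ[ℂ] H)
    (hD : PointsEscape D) : ∃ q ∈ RoeAlg D H, ∃ v ∈ RoeAlg D H, ∃ w ∈ RoeAlg D H,
      q * q = q ∧ star v * v = conjIso (isoD D V) 1 ∧ star w * w = q ∧ star v * w = 0 ∧
      v * star v + w * star w = q := by
  classical
  obtain ⟨β, hβ, φ, hφ, hfin⟩ := hD
  obtain ⟨h, hw⟩ := exists_orthonormal_single (H := H) hH (l := fun p : D × ℕ => φ^[p.2] p.1) hfin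
  have hinj := (shiftEquiv D).injective
  have hw0 := hw.comp (fun x => shiftEquiv D (Sum.inl x)) (hinj.comp Sum.inl_injective)
  have hw1 := hw.comp (fun p => shiftEquiv D (Sum.inr p)) (hinj.comp Sum.inr_injective)
  have hl1 : ∀ y, {p : D × ℕ | φ^[p.2 + 1] p.1 = y}.Finite := fun y =>
    Set.Finite.of_finite_image (f := fun p : D × ℕ => (p.1, p.2 + 1))
      ((hfin y).subset (by rintro _ ⟨p, hp, rfl⟩; exact hp)) (by
        rintro ⟨x, k⟩ - ⟨x', k'⟩ - hxk
        simpa using hxk)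
  have hid : ∀ y : D, {x | x = y}.Finite := fun y => Set.finite_singleton y
  -- `W` sends the basis to all ray vectors, `W0` to those with `k = 0`, `W1` to those with `k ≥ 1`.
  -- The operators of the swindle are `q = W W*`, `v = W0 P*` and `w = W1 W*`.
  let W := (isoOf hw).toContinuousLinearMap
  let W0 := (isoOf hw0).toContinuousLinearMap
  let W1 := (isoOf hw1).toContinuousLinearMap
  let P := (isoD D V).toContinuousLinearMap
  have hW : ∀ p : D × ℕ, W (lp.single 2 p 1) = lp.single 2 (φ^[p.2] p.1) (h p) := isoOf_single hw
  have hW0 : ∀ x : D, W0 (lp.single 2 x 1) = lp.single 2 x (h (x, 0)) := isoOf_single hw0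
  have hW1 : ∀ p : D × ℕ, W1 (lp.single 2 p 1) =
      lp.single 2 (φ^[p.2 + 1] p.1) (h (p.1, p.2 + 1)) := isoOf_single hw1
  have hP : ∀ x : D, P (lp.single 2 x 1) = lp.single 2 x (V 1) := isoD_single V
  have hqS : W ∘L ContinuousLinearMap.adjoint W ∈ RoeAlg D H :=
    comp_adjoint_mem_roeAlg hW hfin hW hfin hβ fun p => by rw [dist_self]; exact hβ.le
  have hvS : W0 ∘L ContinuousLinearMap.adjoint P ∈ RoeAlg D H :=
    comp_adjoint_mem_roeAlg hW0 hid hP hid hβ fun p => by rw [dist_self]; exact hβ.le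
  -- `w` moves each ray vector one step along its ray, hence by at most `β`.
  have hwS : W1 ∘L ContinuousLinearMap.adjoint W ∈ RoeAlg D H :=
    comp_adjoint_mem_roeAlg hW1 hl1 hW hfin hβ fun p => by
      rw [Function.iterate_succ_apply', dist_comm]
      exact (hφ _).2
  have aW : ∀ u, ContinuousLinearMap.adjoint W (W u) = u := adjoint_apply_iso (isoOf hw)
  have aW0 : ∀ u, ContinuousLinearMap.adjoint W0 (W0 u) = u := adjoint_apply_iso (isoOf hw0)
  have aW1 : ∀ u, ContinuousLinearMap.adjoint W1 (W1 u) = u := adjoint_apply_iso (isoOf hw1)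
  have aP : ∀ u, ContinuousLinearMap.adjoint P (P u) = u := adjoint_apply_iso (isoD D V)
  have a01 : ∀ u, ContinuousLinearMap.adjoint W0 (W1 u) = 0 :=
    adjoint_isoOf_comp_eq_zero hw0 hw1 fun x p =>
      hw.2 fun h => absurd (hinj h) (by simp)
  have hsv : star (W0 ∘L ContinuousLinearMap.adjoint P) = P ∘L ContinuousLinearMap.adjoint W0 := by
    rw [ContinuousLinearMap.star_eq_adjoint, ContinuousLinearMap.adjoint_comp,
      ContinuousLinearMap.adjoint_adjoint]
  have hsw : star (W1 ∘L ContinuousLinearMap.adjoint W) = W ∘L ContinuousLinearMap.adjoint W1 := by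
    rw [ContinuousLinearMap.star_eq_adjoint, ContinuousLinearMap.adjoint_comp,
      ContinuousLinearMap.adjoint_adjoint]
  refine ⟨_, hqS, _, hvS, _, hwS, ?_, ?_, ?_, ?_, ?_⟩
  · ext1 u
    change W (ContinuousLinearMap.adjoint W (W (ContinuousLinearMap.adjoint W u))) = _
    rw [aW]
    rfl
  · rw [hsv]
    ext1 u
    change P (ContinuousLinearMap.adjoint W0 (W0 (ContinuousLinearMap.adjoint P u))) = _
    rw [aW0]
    rfl
  · rw [hsw]
    ext1 u
    change W (ContinuousLinearMap.adjoint W1 (W1 (ContinuousLinearMap.adjoint W u))) = _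
    rw [aW1]
    rfl
  · rw [hsv]
    ext1 u
    change P (ContinuousLinearMap.adjoint W0 (W1 (ContinuousLinearMap.adjoint W u))) = 0
    rw [a01, map_zero]
  · rw [hsv, hsw]
    ext1 u
    change W0 (ContinuousLinearMap.adjoint P (P (ContinuousLinearMap.adjoint W0 u))) +
      W1 (ContinuousLinearMap.adjoint W (W (ContinuousLinearMap.adjoint W1 u))) = _
    rw [aP, aW]
    exact isoOf_adjoint_add (shiftEquiv D) hw hw0 hw1 u

theorem iD_unitClass_eq_zero (hH : ¬ FiniteDimensional ℂ H) (V : ℂ →ₗᵢ[ℂ] H)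
    (hD : PointsEscape D) : K0.map (iD D V) (unitClass D) = 0 :=
  (iD_unitClass V).trans (K0.ofProj_eq_zero_of_absorbed_coe (isStarProjection_iD_one D V)
    (exists_absorbing_operators hH V hD))

end Vanishing

/-! ## Isometries of matrices that are not unitary -/

section Isometry

open Matrix

/-- A Murray–von Neumann equivalence `p ⊕ q ~ q` gives an isometry `p ⊕ 1 → 1`. -/
lemma exists_isometry_of_mvN {R : Type*} [Ring R] [StarRing R] {m n : Type*} [Fintype m] [Fintype n]
    [DecidableEq n] {p : Matrix m m R} {q : Matrix n n R} (hp : IsStarProjection p)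
    (hq : IsStarProjection q) (h : MvN (fromBlocks p 0 0 q) q) :
    ∃ Z : Matrix n (m ⊕ n) R, Zᴴ * Z = fromBlocks p 0 0 1 := by
  obtain ⟨v, h1, h2⟩ := h
  have hq1 : qᴴ = q := hq.isSelfAdjoint
  have hq2 : q * q = q := hq.isIdempotentElem
  have hP : fromBlocks p 0 0 q * fromBlocks p 0 0 q = fromBlocks p 0 0 q :=
    (isStarProjection_fromBlocks hp hq).isIdempotentElem
  have hPs : (fromBlocks p 0 0 q)ᴴ = fromBlocks p 0 0 q :=
    (isStarProjection_fromBlocks hp hq).isSelfAdjoint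
  -- The isometry uses `v * P`, since in a general star ring `vᴴ * v = P` need not imply `v * P =
  -- v`.
  set P := fromBlocks p 0 0 q with hPdef
  have hqv : (1 - q) * (v * P) = 0 := by
    rw [Matrix.sub_mul, Matrix.one_mul, sub_eq_zero, ← h2, Matrix.mul_assoc, ← Matrix.mul_assoc vᴴ,
      h1, hP]
  have hvq : (v * P)ᴴ * (1 - q) = 0 := by
    have := congrArg conjTranspose hqv
    rwa [conjTranspose_mul, conjTranspose_sub, conjTranspose_one, hq1, conjTranspose_zero] at this
  have hqq : (1 - q) * (1 - q) = 1 - q := by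
    rw [Matrix.sub_mul, Matrix.mul_sub, Matrix.mul_sub, hq2]
    simp
  set J : Matrix n (m ⊕ n) R := fromCols 0 1 with hJ
  have hJq : Jᴴ * (1 - q) * J = fromBlocks 0 0 0 (1 - q) := by
    rw [hJ, conjTranspose_fromCols_eq_fromRows_conjTranspose, conjTranspose_one,
      conjTranspose_zero, fromRows_mul, fromRows_mul_fromCols]
    simp
  -- The equivalence from `p ⊕ q` to `q` is completed by the identity on the complement `1 - q`,
  -- with `J` the projection to the second summand. The two parts have orthogonal ranges.
  refine ⟨v * P + (1 - q) * J, ?_⟩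
  have e1 : (v * P)ᴴ * (v * P) = P := by
    rw [conjTranspose_mul, hPs, Matrix.mul_assoc, ← Matrix.mul_assoc vᴴ, h1, hP, hP]
  have e2 : (v * P)ᴴ * ((1 - q) * J) = 0 := by rw [← Matrix.mul_assoc, hvq, Matrix.zero_mul]
  have e3 : ((1 - q) * J)ᴴ * (v * P) = 0 := by
    rw [conjTranspose_mul, conjTranspose_sub, conjTranspose_one, hq1, Matrix.mul_assoc, hqv,
      Matrix.mul_zero]
  have e4 : ((1 - q) * J)ᴴ * ((1 - q) * J) = fromBlocks 0 0 0 (1 - q) := by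
    rw [conjTranspose_mul, conjTranspose_sub, conjTranspose_one, hq1, Matrix.mul_assoc,
      ← Matrix.mul_assoc (1 - q), hqq, ← Matrix.mul_assoc, hJq]
  rw [conjTranspose_add, Matrix.add_mul, Matrix.mul_add, Matrix.mul_add, e1, e2, e3, e4, hPdef,
    add_zero, zero_add, fromBlocks_add]
  simp

lemma exists_isometry_of_ofProj_eq_zero {R : Type*} [Ring R] [StarRing R] [Algebra ℂ R]
    [StarModule ℂ R] {S : NonUnitalStarSubalgebra ℂ R} {p : S} (hp : IsStarProjection p)
    (h : K0.ofProj hp = 0) : ∃ (k : ℕ) (Z : Matrix (Fin k) (Fin 1 ⊕ Fin k) R),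
      Zᴴ * Z = fromBlocks (Matrix.of fun _ _ => (p : R)) 0 0 1 ∧
      ∀ i j, ∃ c : ℂ, ∃ T ∈ S, Z i j = algebraMap ℂ R c + T := by
  obtain ⟨q, hq⟩ := (K0.ofProj_eq_zero_iff hp).1 h
  obtain ⟨Z, hZ⟩ : ∃ Z : Matrix (Fin q.size) (Fin 1 ⊕ Fin q.size) (Unitization ℂ S),
      Zᴴ * Z = fromBlocks (Matrix.of fun _ _ => (p : Unitization ℂ S)) 0 0 1 :=
    exists_isometry_of_mvN (projMat hp).isProj q.isProj hq
  -- `ρ` realises the abstract unitization by scalars plus elements of `S`. It need not be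
  -- injective, as only an algebraic identity is transported.
  let ρ : Unitization ℂ S →⋆ₐ[ℂ] R :=
    Unitization.starLift (NonUnitalStarSubalgebraClass.subtype S)
  have hρ : ∀ x, ρ x = algebraMap ℂ R x.fst + (x.snd : R) := fun x => rfl
  refine ⟨q.size, Z.map ρ, ?_, fun i j => ⟨(Z i j).fst, (Z i j).snd, (Z i j).snd.2, hρ _⟩⟩
  rw [← conjTranspose_map _ (map_star ρ), ← Matrix.map_mul]
  refine (congrArg (fun M => M.map ρ) hZ).trans ?_
  rw [fromBlocks_map]
  congr 1
  · refine Matrix.ext fun i j => ?_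
    change ρ (p : Unitization ℂ S) = p
    rw [hρ]
    simp
  · simp
  · simp
  · simp

end Isometry

/-! ## Dimension count -/

section Dimension

open Matrix

variable {E : Type*} [NormedAddCommGroup E] [NormedSpace ℂ E]
  {l m n : Type*} [Fintype l] [Fintype m] [Fintype n]

/-- The action of matrices of operators on vectors. -/
def matAct (B : Matrix m n (E →L[ℂ] E)) : (n → E) →ₗ[ℂ] (m → E) :=
  LinearMap.pi fun i => ∑ j, (B i j).toLinearMap ∘ₗ LinearMap.proj j

omit [Fintype m] in
lemma matAct_apply (B : Matrix m n (E →L[ℂ] E)) (u : n → E) (i : m) :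
    matAct B u i = ∑ j, B i j (u j) := by
  simp [matAct]

omit [Fintype l] in
lemma matAct_mul (A : Matrix l m (E →L[ℂ] E)) (B : Matrix m n (E →L[ℂ] E)) (u : n → E) :
    matAct (A * B) u = matAct A (matAct B u) := by
  ext i
  simp only [matAct_apply, Matrix.mul_apply, map_sum, _root_.sum_apply, mul_apply_eq_comp]
  exact Finset.sum_comm

lemma norm_matAct_le (B : Matrix m n (E →L[ℂ] E)) (u : n → E) :
    ‖matAct B u‖ ≤ (∑ i, ∑ j, ‖B i j‖) * ‖u‖ := by
  refine (pi_norm_le_iff_of_nonneg (by positivity)).2 fun i => ?_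
  rw [matAct_apply]
  calc ‖∑ j, B i j (u j)‖ ≤ ∑ j, ‖B i j (u j)‖ := norm_sum_le _ _
    _ ≤ ∑ j, ‖B i j‖ * ‖u‖ := by
        gcongr with j
        exact ((B i j).le_opNorm _).trans (by gcongr; exact norm_le_pi_norm u j)
    _ = (∑ j, ‖B i j‖) * ‖u‖ := (Finset.sum_mul _ _ _).symm
    _ ≤ _ := by
        gcongr
        exact Finset.single_le_sum (f := fun i => ∑ j, ‖B i j‖)
          (fun i _ => by positivity) (Finset.mem_univ i)

lemma matAct_fromBlocks_one [DecidableEq n] (p : E →L[ℂ] E) (u : Fin 1 ⊕ n → E)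
    (hu : p (u (Sum.inl 0)) = u (Sum.inl 0)) :
    matAct (fromBlocks (Matrix.of fun _ _ : Fin 1 => p) 0 0 1) u = u := by
  ext (i | i)
  · fin_cases i
    simpa [matAct_apply] using hu
  · rw [matAct_apply, Fintype.sum_sum_type, Finset.sum_eq_single (a := i) (s := Finset.univ)
      (f := fun j => fromBlocks (Matrix.of fun _ _ : Fin 1 => p) 0 0 1 (Sum.inr i) (Sum.inr j)
        (u (Sum.inr j)))]
    · simp
    · intro j _ hj
      simp [Matrix.one_apply_ne hj.symm]
    · simp

/-- An isometry `p ⊕ 1 → 1` does not almost commute with projections of finite rank that contain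
vectors of `p`. -/
lemma exists_commutator_gap {k : ℕ} {Z : Matrix (Fin k) (Fin 1 ⊕ Fin k) (E →L[ℂ] E)}
    {Z' : Matrix (Fin 1 ⊕ Fin k) (Fin k) (E →L[ℂ] E)} {p : E →L[ℂ] E}
    (hZ : Z' * Z = fromBlocks (Matrix.of fun _ _ => p) 0 0 1) :
    ∃ ε : ℝ, 0 < ε ∧ ∀ (F : E →L[ℂ] E) (x : E), FiniteDimensional ℂ F.range → F * F = F →
      F x = x → p x = x → (∀ i j, ‖F * Z i j - Z i j * F‖ ≤ ε) → x = 0 := by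
  set N : ℝ := ∑ i, ∑ j, ‖Z' i j‖ with hN
  have hN0 : 0 ≤ N := by positivity
  -- `N` bounds the action of `Z'`, and `k * (1 + k)` is the number of entries of `Z`. The summand
  -- `1` makes `N * (k * (1 + k)) * ε < 1`.
  refine ⟨1 / (N * (k * (1 + k)) + 1), by positivity, fun F x hF hFF hFx hpx hcomm => ?_⟩
  set ε : ℝ := 1 / (N * (k * (1 + k)) + 1) with hε
  by_contra hx0
  let U := F.range
  have hFU : ∀ u : U, F u = u := by
    rintro ⟨_, u, rfl⟩
    exact DFunLike.congr_fun hFF u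
  -- `Ξ` includes `ℂ x ⊕ (ran F)^k` in `E^(1 + k)`, and `Φ` is the compression `F Z Ξ`.
  let Ξ : (ℂ × (Fin k → U)) →ₗ[ℂ] (Fin 1 ⊕ Fin k → E) :=
    LinearMap.pi (Sum.elim (fun _ => (LinearMap.toSpanSingleton ℂ E x) ∘ₗ LinearMap.fst ℂ ℂ _)
      fun j => U.subtype ∘ₗ LinearMap.proj j ∘ₗ LinearMap.snd ℂ ℂ _)
  let Φ : (ℂ × (Fin k → U)) →ₗ[ℂ] (Fin k → U) :=
    LinearMap.pi fun i => F.toLinearMap.rangeRestrict ∘ₗ LinearMap.proj i ∘ₗ matAct Z ∘ₗ Ξ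
  have hinj : Function.Injective Φ := by
    refine (injective_iff_map_eq_zero Φ).2 fun w hw => ?_
    have hΞF : ∀ j, F (Ξ w j) = Ξ w j := by
      rintro (j | j)
      · change F (w.1 • x) = w.1 • x
        rw [map_smul, hFx]
      · exact hFU (w.2 j)
    have hΞp : p (Ξ w (Sum.inl 0)) = Ξ w (Sum.inl 0) := by
      change p (w.1 • x) = w.1 • x
      rw [map_smul, hpx]
    have hFZ : ∀ i, F (matAct Z (Ξ w) i) = 0 := fun i => congrArg Subtype.val (congrFun hw i)
    -- On the kernel of `Φ` the matrix `Z` acts as its commutator with `F`, hence with small norm,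
    -- while `Z' * Z` fixes `Ξ w`. This forces `Ξ w = 0`.
    have hM : matAct Z (Ξ w) = matAct (Matrix.of fun i j => Z i j * F - F * Z i j) (Ξ w) := by
      ext i
      have h := hFZ i
      rw [matAct_apply, map_sum] at h
      rw [matAct_apply, matAct_apply]
      simp only [Matrix.of_apply, _root_.sub_apply, mul_apply_eq_comp, Finset.sum_sub_distrib, h, sub_zero,
        hΞF]
    have hn1 : ‖matAct Z (Ξ w)‖ ≤ (k * (1 + k) * ε) * ‖Ξ w‖ := by
      rw [hM]
      refine (norm_matAct_le _ _).trans ?_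
      gcongr
      calc _ ≤ ∑ _i : Fin k, ∑ _j : Fin 1 ⊕ Fin k, ε := by
            gcongr with i _ j _
            rw [Matrix.of_apply, norm_sub_rev]
            exact hcomm i j
        _ = _ := by simp; ring
    have hn2 : ‖Ξ w‖ ≤ N * (k * (1 + k) * ε * ‖Ξ w‖) := by
      have h1 : matAct Z' (matAct Z (Ξ w)) = Ξ w := by
        rw [← matAct_mul, hZ, matAct_fromBlocks_one p _ hΞp]
      calc ‖Ξ w‖ = ‖matAct Z' (matAct Z (Ξ w))‖ := by rw [h1]
        _ ≤ N * ‖matAct Z (Ξ w)‖ := norm_matAct_le _ _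
        _ ≤ _ := by gcongr
    have hlt : N * (k * (1 + k)) * ε < 1 := by
      rw [hε, mul_one_div, div_lt_one (by positivity)]
      linarith
    have h0 : ‖Ξ w‖ = 0 := by
      have := norm_nonneg (Ξ w)
      by_contra hne
      have hpos : 0 < ‖Ξ w‖ := lt_of_le_of_ne this (Ne.symm hne)
      nlinarith
    have hΞ0 : ∀ j, Ξ w j = 0 := fun j => congrFun (norm_eq_zero.1 h0) j
    refine Prod.ext ?_ (funext fun j => Subtype.ext (hΞ0 (Sum.inr j)))
    have : w.1 • x = 0 := hΞ0 (Sum.inl 0)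
    exact (smul_eq_zero.1 this).resolve_right hx0
  -- Injectivity gives `1 + k * dim U ≤ k * dim U`.
  have := LinearMap.finrank_le_finrank_of_injective hinj
  rw [Module.finrank_prod, Module.finrank_self] at this
  omega

end Dimension

/-! ## Projections of finite rank that almost commute with an operator -/

section AlmostCommuting

variable {E : Type*} [NormedAddCommGroup E] [InnerProductSpace ℂ E]

lemma norm_sub_starProjection_le (U : Submodule ℂ E) [U.HasOrthogonalProjection] (v : E) {u : E}
    (hu : u ∈ U) : ‖v - U.starProjection v‖ ≤ ‖v - u‖ := by
  rw [Submodule.starProjection_minimal]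
  exact ciInf_le ⟨0, by rintro _ ⟨w, rfl⟩; exact norm_nonneg _⟩ (⟨u, hu⟩ : U)

/-- `U` is spanned by a finite `ε`-net in the image of the open ball of radius `2`, which contains
all unit vectors. Placing `U` inside the range of `K` later keeps it in the space fixed by the
cut-off. -/
lemma exists_finiteDimensional_approx {K : E →L[ℂ] E} (hK : IsCompactOperator K) {ε : ℝ}
    (hε : 0 < ε) : ∃ U : Submodule ℂ E, FiniteDimensional ℂ U ∧ U ≤ K.range ∧
      ∀ (W : Submodule ℂ E) [W.HasOrthogonalProjection], U ≤ W → ‖W.starProjection * K - K‖ ≤ ε := by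
  have h1 := hK.isCompact_closure_image_ball (𝕜₁ := ℂ) (f := K.toLinearMap) 2
  obtain ⟨t, hts, htf, htc⟩ :=
    Metric.finite_approx_of_totallyBounded (h1.totallyBounded.subset subset_closure) ε hε
  refine ⟨Submodule.span ℂ t, FiniteDimensional.span_of_finite ℂ htf, ?_, fun W _ hW => ?_⟩
  · refine Submodule.span_le.2 fun y hy => ?_
    obtain ⟨u, -, hu⟩ := hts hy
    exact ⟨u, hu⟩
  · refine ContinuousLinearMap.opNorm_le_of_unit_norm hε.le fun v hv => ?_
    have hvb : K v ∈ K.toLinearMap '' Metric.ball 0 2 :=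
      ⟨v, by rw [mem_ball_zero_iff, hv]; norm_num, rfl⟩
    obtain ⟨y, hy, hvy⟩ := Set.mem_iUnion₂.1 (htc hvb)
    rw [Metric.mem_ball, dist_eq_norm] at hvy
    change ‖W.starProjection (K v) - K v‖ ≤ ε
    rw [norm_sub_rev]
    exact (norm_sub_starProjection_le W (K v) (hW (Submodule.subset_span hy))).trans hvy.le

variable [CompleteSpace E]

/-- As `X` fixes the range of `F`, the operator `T` may be replaced by its cut-off `K` in `F T` and
`T F`. Both `F K` and `K F = (F K*)*` are within `ε` of `K`. -/
lemma norm_starProjection_commutator_le {W : Submodule ℂ E} [W.HasOrthogonalProjection]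
    {X T K : E →L[ℂ] E} (hX : ∀ w ∈ W, X w = w) (hXs : star X = X) (hXT : X * T = K)
    (hTX : T * X = K) {ε : ℝ} (h1 : ‖W.starProjection * K - K‖ ≤ ε)
    (h2 : ‖W.starProjection * star K - star K‖ ≤ ε) :
    ‖W.starProjection * T - T * W.starProjection‖ ≤ 2 * ε := by
  set F := W.starProjection with hF
  have hFs : star F = F := isSelfAdjoint_starProjection W
  have hXF : X * F = F := by
    ext1 v
    exact hX _ (Submodule.starProjection_apply_mem W v)
  have hFX : F * X = F := by
    have := congrArg star hXF
    rwa [star_mul, hFs, hXs] at this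
  have e1 : F * T = F * K := by rw [← hXT, ← mul_assoc, hFX]
  have e2 : T * F = K * F := by rw [← hTX, mul_assoc, hXF]
  have e3 : ‖K * F - K‖ ≤ ε := by
    rw [← norm_star, star_sub, star_mul, hFs]
    exact h2
  rw [e1, e2, show F * K - K * F = (F * K - K) - (K * F - K) by abel]
  refine (norm_sub_le _ _).trans ?_
  linarith

end AlmostCommuting

/-! ### Cutting Roe operators down to isolated finite sets, and nonvanishing of the unit class -/

section RoeAlmostCommuting

variable {D : Type*} [MetricSpace D] [DiscreteTopology D]
  {H : Type*} [NormedAddCommGroup H] [InnerProductSpace ℂ H] [CompleteSpace H]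

/-- Multiplication by the characteristic function of a finite set. -/
abbrev charOp (D H : Type*) [MetricSpace D] [DiscreteTopology D] [NormedAddCommGroup H]
    [InnerProductSpace ℂ H] [CompleteSpace H] (C : Finset D) : L2 D H →L[ℂ] L2 D H :=
  mulRep D H (restrictFinset 1 C)

lemma charOp_apply_of_mem {C : Finset D} {x : D} (hx : x ∈ C) (v : L2 D H) :
    charOp D H C v x = v x := by
  have : restrictFinset (1 : D → ℂ) C x = 1 := Set.indicator_of_mem (Finset.mem_coe.2 hx) _
  rw [mulRep_apply, this, one_smul]

lemma charOp_apply_of_notMem {C : Finset D} {x : D} (hx : x ∉ C) (v : L2 D H) :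
    charOp D H C v x = 0 := by
  have : restrictFinset (1 : D → ℂ) C x = 0 :=
    Set.indicator_of_notMem (fun h => hx (Finset.mem_coe.1 h)) _
  rw [mulRep_apply, this, zero_smul]

lemma charOp_eq_self {C : Finset D} {v : L2 D H} (hv : ∀ x ∉ C, v x = 0) :
    charOp D H C v = v := by
  ext x
  by_cases hx : x ∈ C
  · exact charOp_apply_of_mem hx v
  · rw [charOp_apply_of_notMem hx, hv x hx]

lemma star_charOp (C : Finset D) : star (charOp D H C) = charOp D H C := by
  rw [← map_star]
  congr 1
  ext x
  change star ((C : Set D).indicator (1 : D → ℂ) x) = (C : Set D).indicator (1 : D → ℂ) x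
  by_cases hx : x ∈ (C : Set D) <;> simp [hx]

lemma tsupport_restrictFinset_subset (f : D → ℂ) (C : Finset D) :
    tsupport (restrictFinset f C) ⊆ C := by
  rw [tsupport, (isClosed_discrete _).closure_eq]
  exact Set.support_indicator_subset

/-- Operators of small propagation preserve the vectors supported in an isolated set. -/
lemma charOp_mul_mul_charOp {T : L2 D H →L[ℂ] L2 D H} {R : ℝ} (hR : 0 < R)
    (hT : ∀ f g : C₀(D, ℂ), ENNReal.ofReal R < setDist (tsupport f) (tsupport g) →
      mulRep D H f * T * mulRep D H g = 0) {C : Finset D}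
    (hC : ∀ x ∈ C, ∀ y ∉ C, R + 1 < dist x y) :
    charOp D H C * T * charOp D H C = T * charOp D H C := by
  ext1 u
  refine charOp_eq_self fun y hy => ?_
  have h := hT (restrictFinset 1 {y}) (restrictFinset 1 C)
    (ofReal_lt_setDist (S := R + 1) (by linarith) (by linarith) fun z hz x hx => by
      have hz' := tsupport_restrictFinset_subset _ _ hz
      have hx' := tsupport_restrictFinset_subset _ _ hx
      rw [Finset.coe_singleton, Set.mem_singleton_iff] at hz'
      rw [hz', dist_comm]
      exact (hC x hx' y hy).le)
  have h' := congrArg (fun v : L2 D H => v y) (DFunLike.congr_fun h u)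
  change charOp D H {y} (T (charOp D H C u)) y = 0 at h'
  rwa [charOp_apply_of_mem (Finset.mem_singleton_self y)] at h'

/-- Invariance of the vectors supported in `C` under both `T` and `star T` makes this subspace
reducing for `T`. -/
lemma mul_charOp_comm {T : L2 D H →L[ℂ] L2 D H} {R : ℝ} (hR : 0 < R)
    (hT : ∀ f g : C₀(D, ℂ), ENNReal.ofReal R < setDist (tsupport f) (tsupport g) →
      mulRep D H f * T * mulRep D H g = 0) {C : Finset D}
    (hC : ∀ x ∈ C, ∀ y ∉ C, R + 1 < dist x y) :
    T * charOp D H C = charOp D H C * T := by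
  have hTs : ∀ f g : C₀(D, ℂ), ENNReal.ofReal R < setDist (tsupport f) (tsupport g) →
      mulRep D H f * star T * mulRep D H g = 0 := fun f g hfg => by
    have hs : ∀ k : C₀(D, ℂ), tsupport (star k : C₀(D, ℂ)) = tsupport k := fun k => by
      unfold tsupport Function.support
      simp
    have := hT (star g) (star f) (by rw [hs, hs, setDist_comm]; exact hfg)
    simpa [map_star, mul_assoc] using congrArg star this
  have h := congrArg star (charOp_mul_mul_charOp hR hTs hC)
  rw [star_mul, star_mul, star_mul, star_star, star_charOp] at h
  rw [← charOp_mul_mul_charOp hR hT hC, mul_assoc, h]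

/-- In the presence of isolated finite sets, there are projections of finite rank that almost
commute with given elements of the Roe algebra. -/
lemma exists_almost_commuting_projection (hD : HasIsolatedFinsets D) {ι : Type*} [Fintype ι]
    {T : ι → L2 D H →L[ℂ] L2 D H} (hT : ∀ i, T i ∈ RoeAlg D H) (h : D → L2 D H)
    (hh : ∀ x y, y ≠ x → h x y = 0) {ε : ℝ} (hε : 0 < ε) :
    ∃ (x : D) (F : L2 D H →L[ℂ] L2 D H), FiniteDimensional ℂ F.range ∧ F * F = F ∧
      F (h x) = h x ∧ ∀ i, ‖F * T i - T i * F‖ ≤ ε := by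
  have happ : ∀ i, ∃ S, (IsLocallyCompactOp (mulRep D H) S ∧
      HasFinitePropagation (mulRep D H) S) ∧ ‖T i - S‖ < ε / 4 := fun i => by
    obtain ⟨S, hS, hd⟩ := Metric.mem_closure_iff.1 (hT i) (ε / 4) (by positivity)
    exact ⟨S, hS, by rwa [← dist_eq_norm]⟩
  choose S hS hTS using happ
  choose hSc R hR hSR using hS
  -- One scale that serves all the operators `S i` at once.
  let r : ℝ := ∑ i, R i + 1
  have hRr : ∀ i, R i ≤ ∑ i, R i := fun i =>
    Finset.single_le_sum (fun j _ => (hR j).le) (Finset.mem_univ i)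
  obtain ⟨C, ⟨x, hx⟩, hC⟩ := hD r (by
    have : 0 ≤ ∑ i, R i := Finset.sum_nonneg fun j _ => (hR j).le
    positivity)
  have hCi : ∀ i, ∀ x ∈ C, ∀ y ∉ C, R i + 1 < dist x y := fun i x hx y hy =>
    lt_of_le_of_lt (by linarith [hRr i]) (hC x hx y hy)
  let X := charOp D H C
  let K : ι → L2 D H →L[ℂ] L2 D H := fun i => X * S i
  have hK : ∀ i, IsCompactOperator (K i) := fun i => (hSc i _).2
  have hSX : ∀ i, S i * X = K i := fun i => mul_charOp_comm (hR i) (hSR i) (hCi i)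
  have hXX : X * X = X := by
    ext1 v
    exact charOp_eq_self fun y hy => charOp_apply_of_notMem hy v
  have hXK : ∀ i v, X (K i v) = K i v := fun i v =>
    DFunLike.congr_fun (show X * K i = K i by rw [← mul_assoc, hXX]) v
  have hXKs : ∀ i v, X (star (K i) v) = star (K i) v := fun i v =>
    DFunLike.congr_fun (show X * star (K i) = star (K i) by
      rw [← hSX, star_mul, star_charOp, ← mul_assoc, hXX]) v
  choose U hUf hUr hU using fun i => exists_finiteDimensional_approx (hK i)
    (ε := ε / 4) (by positivity)
  choose U' hUf' hUr' hU' using fun i => exists_finiteDimensional_approx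
    (isCompactOperator_adjoint (hK i)) (ε := ε / 4) (by positivity)
  -- The range of `X` is infinite-dimensional when `H` is, so `X` itself cannot serve as `F`. The
  -- compact operators `X * S i` and their adjoints are captured up to `ε / 4` by a
  -- finite-dimensional subspace, and `h x` is added to it.
  let W : Submodule ℂ (L2 D H) := (⨆ i, U i) ⊔ (⨆ i, U' i) ⊔ Submodule.span ℂ {h x}
  have hWX : W ≤ LinearMap.eqLocus X.toLinearMap LinearMap.id := by
    refine sup_le (sup_le (iSup_le fun i => (hUr i).trans ?_)
      (iSup_le fun i => (hUr' i).trans ?_)) (Submodule.span_le.2 ?_)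
    · rintro _ ⟨v, rfl⟩
      exact hXK i v
    · rintro _ ⟨v, rfl⟩
      exact hXKs i v
    · rintro _ rfl
      exact charOp_eq_self fun y hy => hh x y fun hyx => hy (hyx ▸ hx)
  have hx' : h x ∈ W := Submodule.mem_sup_right (Submodule.mem_span_singleton_self _)
  refine ⟨x, W.starProjection, ?_, Submodule.isIdempotentElem_starProjection W,
    Submodule.starProjection_eq_self_iff.2 hx', fun i => ?_⟩
  · rw [Submodule.range_starProjection]
    infer_instance
  · have h1 := norm_starProjection_commutator_le (W := W) (X := X) (fun w hw => hWX hw)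
      (star_charOp C) (rfl : X * S i = K i) (hSX i)
      (hU i W (le_sup_of_le_left (le_sup_of_le_left (le_iSup U i))))
      (hU' i W (le_sup_of_le_left (le_sup_of_le_right (le_iSup U' i))))
    set F := W.starProjection
    have hF1 : ‖F‖ ≤ 1 := Submodule.starProjection_norm_le W
    -- The commutator with `S i` costs `2 * (ε / 4)`, and the two terms with `T i - S i` cost `ε /
    -- 4` each.
    have e : F * T i - T i * F = (F * S i - S i * F) + (F * (T i - S i) - (T i - S i) * F) := by
      rw [mul_sub, sub_mul]; abel
    have h2 : ‖F * (T i - S i)‖ ≤ ε / 4 := by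
      refine (norm_mul_le _ _).trans ?_
      nlinarith [norm_nonneg F, norm_nonneg (T i - S i), hTS i]
    have h3 : ‖(T i - S i) * F‖ ≤ ε / 4 := by
      refine (norm_mul_le _ _).trans ?_
      nlinarith [norm_nonneg F, norm_nonneg (T i - S i), hTS i]
    rw [e]
    refine (norm_add_le _ _).trans ?_
    have := norm_sub_le (F * (T i - S i)) ((T i - S i) * F)
    linarith

lemma iD_one_apply_single [DecidableEq D] (V : ℂ →ₗᵢ[ℂ] H) (x : D) :
    (iD D V (uniformRoeOne D) : L2 D H →L[ℂ] L2 D H) (lp.single 2 x (V 1)) =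
      lp.single 2 x (V 1) := by
  rw [← isoD_single]
  exact congrArg (isoD D V) (adjoint_apply_iso (isoD D V) _)

theorem iD_unitClass_ne_zero (V : ℂ →ₗᵢ[ℂ] H) (hD : HasIsolatedFinsets D) :
    K0.map (iD D V) (unitClass D) ≠ 0 := by
  classical
  intro h0
  obtain ⟨k, Z, hZ, hent⟩ :=
    exists_isometry_of_ofProj_eq_zero (isStarProjection_iD_one D V) ((iD_unitClass V).symm.trans h0)
  choose c T hT hcT using hent
  obtain ⟨ε, hε, hgap⟩ := exists_commutator_gap hZ
  obtain ⟨x, F, hF, hFF, hFx, hFT⟩ := exists_almost_commuting_projection hD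
    (ι := Fin k × (Fin 1 ⊕ Fin k)) (T := fun i => T i.1 i.2) (fun i => hT i.1 i.2)
    (fun x => lp.single 2 x (V 1)) (fun x y hy => lp.single_apply_ne _ _ _ hy) hε
  -- The scalar part of each entry commutes with `F`, so only the Roe part contributes to the
  -- commutator.
  have h := hgap F _ hF hFF hFx (iD_one_apply_single V x) fun i j => by
    rw [hcT, mul_add, add_mul, ← Algebra.commutes (c i j) F, add_sub_add_left_eq_sub]
    exact hFT (i, j)
  have hn : ‖(lp.single 2 x (V 1) : L2 D H)‖ = 1 := by
    rw [lp.norm_single (by norm_num), V.norm_map, norm_one]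
  rw [h, norm_zero] at hn
  exact zero_ne_one hn

end RoeAlmostCommuting

end CoarseK

end

/-! ### The equivalence: both classes vanish, or neither does -/

theorem corollary3p6 (D : Type*) [MetricSpace D] [CoarseK.IsUniformlyDiscrete D]
    [CoarseK.HasBoundedGeometry D]
    (H : Type*) [NormedAddCommGroup H] [InnerProductSpace ℂ H] [CompleteSpace H]
    (hH : ¬ FiniteDimensional ℂ H) (V : ℂ →ₗᵢ[ℂ] H) (α : Set.Ioi (0 : ℝ)) :
    CoarseK.K0.map (CoarseK.iD D V) (CoarseK.unitClass D) = 0 ↔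
      CoarseK.toBMLimit D α (CoarseK.bmOnes (CoarseK.ripsGraph D α)) = 0 :=
  CoarseK.pointsEscape_or_hasIsolatedFinsets.elim
    (fun h => iff_of_true (CoarseK.iD_unitClass_eq_zero hH V h)
      (CoarseK.bmOnes_eq_zero_of_pointsEscape h α))
    (fun h => iff_of_false (CoarseK.iD_unitClass_ne_zero V h)
      (CoarseK.bmOnes_ne_zero_of_hasIsolatedFinsets h α))
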